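/- **Theorem.** For a continuous function $h:\mathbb R^2\to[0,\infty)$ let $\Omega_h:=\{(x,y,z)\in\mathbb R^3: 0<z<h(x,y)\}$. For $V>0$ let $$F^{3D}_s(V):=\inf\left\{\int_{\Omega_h}|\nabla u|^2\,dx\,dy\,dz+\int_{\mathbb R^2}|\nabla h|^2\,dx\,dy\right\}\in[0,\infty],$$ where the infimum is taken over all pairs $(u,h)$ such that $h\in W^{1,\infty}(\mathbb R^2)$ (continuous representative), $h\ge 0$, $h$ is integrable with $\int_{\mathbb R^2}h\,dx\,dy=V$, $u\in H^1(\Omega_h;\mathbb R^2)$, and $u(x,y,0)=(x,y)$ on $\{(x,y):h(x,y)>0\}$ in the sense of traces. Here $|\nabla u|^2$ is the sum of the squares of all six partial derivatives $\partial_j u_i$. Then there is a constant $c>0$ such that for every $V>0$ $$c\,\min\{V,V^{6/7}\}\le F^{3D}_s(V)\le c^{-1}\min\{V,V^{6/7}\}.$$ -/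

import Mathlib

open MeasureTheory
open scoped ENNReal ContDiff

namespace ThinFilm

/-- The plane with coordinates `(x, y)`; `volume` is Lebesgue measure. -/
abbrev Plane : Type := ℝ × ℝ

/-- Three-dimensional space with coordinates `((x, y), z)`; `volume` is Lebesgue measure. -/
abbrev Space : Type := (ℝ × ℝ) × ℝ

/-- The coordinate directions `x, y` of the plane. -/
def dir2 : Fin 2 → Plane := ![(1, 0), (0, 1)]

/-- The coordinate directions `x, y, z` of space. -/
def dir3 : Fin 3 → Space := ![((1, 0), 0), ((0, 1), 0), ((0, 0), 1)]

/-- `f` belongs to the Sobolev space `W^{1,p}(Ω)` (with `Ω` open and `1 ≤ p ≤ ∞`), and the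
components of `G` are its weak partial derivatives in the coordinate directions `e`:
`f` and `G` are in `L^p(Ω)` and `∫_Ω f ∂_j φ = - ∫_Ω G_j φ` for all `φ ∈ C_c^∞(Ω)`. -/
structure IsSobolev {E : Type*} [NormedAddCommGroup E] [NormedSpace ℝ E] [MeasureSpace E]
    {n : ℕ} (e : Fin n → E) (Ω : Set E) (p : ℝ≥0∞) (f : E → ℝ) (G : E → Fin n → ℝ) :
    Prop where
  memLp : MemLp f p (volume.restrict Ω)
  memLp_grad : ∀ j, MemLp (fun x => G x j) p (volume.restrict Ω)
  weak_grad : ∀ (j : Fin n) (φ : E → ℝ), ContDiff ℝ ∞ φ → HasCompactSupport φ →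
    tsupport φ ⊆ Ω → ∫ x in Ω, f x * fderiv ℝ φ x (e j) = - ∫ x in Ω, G x j * φ x

/-- The film `Ω_h = {(x, y, z) : 0 < z < h(x, y)}`. -/
def film (h : Plane → ℝ) : Set Space := {q | 0 < q.2 ∧ q.2 < h q.1}

/-- The film, extended to all `z ≤ 0` below its bottom face `{z = 0, h > 0}`. A smooth function
with compact support in this set is a test function on `Ω_h` that need not vanish on the bottom
face, but vanishes near the rest of the boundary of `Ω_h`. -/
def filmBelow (h : Plane → ℝ) : Set Space := {q | 0 < h q.1 ∧ q.2 < h q.1}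

/-- The trace of `v ∈ H^1(Ω_h)` on the bottom face `{z = 0, h > 0}` of the film is `g`, where `vz`
is the weak derivative of `v` in direction `z`. The trace is determined by Green's formula; the
outer normal on the bottom face is `-e_z`. -/
def HasBottomTrace (h : Plane → ℝ) (v vz : Space → ℝ) (g : Plane → ℝ) : Prop :=
  ∀ φ : Space → ℝ, ContDiff ℝ ∞ φ → HasCompactSupport φ → tsupport φ ⊆ filmBelow h →
    ∫ q in film h, v q * fderiv ℝ φ q (dir3 2) =
      - (∫ q in film h, vz q * φ q) - ∫ s : Plane, g s * φ (s, 0)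

/-- Admissible configurations of volume `V`: a profile `h` with gradient `Dh`, and a displacement
`u : Ω_h → ℝ²` (components `u 0`, `u 1`) with gradient `Du` (`Du q i j = ∂_j u_i (q)`). The profile
`h ∈ W^{1,∞}(ℝ²)` is given by its continuous representative, so that `Ω_h` is open. -/
structure Admissible (V : ℝ) (h : Plane → ℝ) (Dh : Plane → Fin 2 → ℝ)
    (u : Fin 2 → Space → ℝ) (Du : Space → Fin 2 → Fin 3 → ℝ) : Prop where
  continuous_profile : Continuous h
  profile_nonneg : ∀ s, 0 ≤ h s
  sobolev_profile : IsSobolev dir2 Set.univ ∞ h Dh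
  integrable_profile : Integrable h
  volume_eq : ∫ s, h s = V
  sobolev_displacement : ∀ i, IsSobolev dir3 (film h) 2 (u i) (fun q => Du q i)
  trace_fst : HasBottomTrace h (u 0) (fun q => Du q 0 2) (fun s => s.1)
  trace_snd : HasBottomTrace h (u 1) (fun q => Du q 1 2) (fun s => s.2)

/-- The energy `∫_{Ω_h} |∇u|² + ∫_{ℝ²} |∇h|²`, with value `∞` allowed. -/
noncomputable def energy (h : Plane → ℝ) (Dh : Plane → Fin 2 → ℝ)
    (Du : Space → Fin 2 → Fin 3 → ℝ) : ℝ≥0∞ :=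
  (∫⁻ q in film h, ENNReal.ofReal (∑ i, ∑ j, (Du q i j) ^ 2)) +
    ∫⁻ s, ENNReal.ofReal (∑ j, (Dh s j) ^ 2)

/-- The minimal energy `F_s^{3D}(V)` of a film of volume `V`. -/
noncomputable def minEnergy (V : ℝ) : ℝ≥0∞ :=
  sInf {E | ∃ (h : Plane → ℝ) (Dh : Plane → Fin 2 → ℝ) (u : Fin 2 → Space → ℝ)
    (Du : Space → Fin 2 → Fin 3 → ℝ), Admissible V h Dh u Du ∧ E = energy h Dh Du}

end ThinFilm

/-! Elastic cost. In a vertical slice `y = const`, let `h` exceed `R` over an interval of length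
`R`. Test `(∂_x u₁, ∂_z u₁)` against the rotated gradient `(∂_z ψ, -∂_x ψ)` of a cutoff `ψ` adapted
to the `R × R` square above it. This field is divergence free, so only the boundary term remains; as
`u₁ = x` on the bottom, it is of order `R`. Since `|∇ψ| ≲ 1/R`, Cauchy–Schwarz gives elastic energy
at least `c R²` in the square (`exists_ae_cellEnergyBound`).

Lower bound. Let `K` be the elastic and `D` the Dirichlet energy. Almost every point with `h > 0`
has, in each horizontal direction, a largest dyadic interval through it over which `h` exceeds the
length `2^j`. The points where `h ≤ 8 · 2^j` for one of the two directions carry volume at most `C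
K`, by the elastic cost. At the other points the parent interval contains a point with `h ≤
2^(j+1)`, so `h` drops by at least half its value within length `2^(j+1)`; this gives `∫ h² ≤ 16 ·
4^j D` over these points (`CellOscBound.tall_le`).

Take `2^j` to be the smaller of the two lengths. The point is then good at scale `2^j` in both
directions, and the set of such points has area at most a constant times `min(K/2^j, (K/4^j)²)`: the
first bound sums the elastic cost over cells, the second holds because each projection to an axis
has length at most `C K/4^j` (`SliceBounds.volume_crossSet_le`). By Cauchy–Schwarz the volume at
scale `j` is at most `C (min(K 2^j, K² 4^(-j)) D)^(1/2)`, which peaks at `2^j ~ K^(1/3)` and decays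
geometrically on both sides. Summing over `j` gives `V ≤ C (K + K^(2/3) D^(1/2)) ≤ C (E + E^(7/6))`
for the total energy `E` (`SliceBounds.lintegral_le`).

Upper bound. A smooth bump of width `R` and volume `V` has Dirichlet energy of order `V²/R⁴`. The
displacement `(x, y)`, cut off between heights `R` and `2R`, has bounded gradient over the bump and
vanishes above `2R`, so it costs at most a multiple of `min(V, R³)`. Take `R = 1` for `V ≤ 1` and `R
= V^(2/7)` for `V ≥ 1`. -/

namespace ThinFilm

open Filter Topology

/-! ### Dyadic stopping intervals on a line. -/

/-- The closed dyadic interval of length `2 ^ j` with index `k`. -/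
def dyadic (j k : ℤ) : Set ℝ := Set.Icc (k * 2 ^ j) ((k + 1) * 2 ^ j)

/-- The half-open dyadic interval of length `2 ^ j` with index `k`. -/
def cell (j k : ℤ) : Set ℝ := Set.Ico (k * 2 ^ j) ((k + 1) * 2 ^ j)

/-- The index of the dyadic interval of length `2 ^ j` that contains `x`. -/
noncomputable def idx (j : ℤ) (x : ℝ) : ℤ := ⌊x / 2 ^ j⌋

theorem mem_cell_iff {j k : ℤ} {x : ℝ} : x ∈ cell j k ↔ idx j x = k := by
  have h2 : (0 : ℝ) < 2 ^ j := by positivity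
  rw [idx, Int.floor_eq_iff, cell, Set.mem_Ico, le_div_iff₀ h2, div_lt_iff₀ h2]

theorem mem_cell_idx (j : ℤ) (x : ℝ) : x ∈ cell j (idx j x) := mem_cell_iff.2 rfl

theorem cell_subset_dyadic (j k : ℤ) : cell j k ⊆ dyadic j k := Set.Ico_subset_Icc_self

theorem mem_dyadic_idx (j : ℤ) (x : ℝ) : x ∈ dyadic j (idx j x) :=
  cell_subset_dyadic _ _ (mem_cell_idx j x)

theorem idx_succ (j : ℤ) (x : ℝ) : idx (j + 1) x = idx j x / 2 := by
  have h2 : (2 : ℝ) ^ j ≠ 0 := by positivity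
  rw [idx, idx, zpow_add₀ (by norm_num), zpow_one, ← div_div]
  exact_mod_cast Int.floor_div_natCast (x / 2 ^ j) 2

theorem dyadic_subset_parent (j k : ℤ) : dyadic j k ⊆ dyadic (j + 1) (k / 2) := by
  have h2 : (0 : ℝ) < 2 ^ j := by positivity
  have hz : (2 : ℝ) ^ (j + 1) = 2 * 2 ^ j := by
    rw [zpow_add₀ (by norm_num), zpow_one, mul_comm]
  have h1 : 2 * (k / 2) ≤ k := by lia
  have h3 : k + 1 ≤ 2 * (k / 2) + 2 := by lia
  have h1' : (2 : ℝ) * ((k / 2 : ℤ) : ℝ) ≤ k := by exact_mod_cast h1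
  have h3' : (k : ℝ) + 1 ≤ 2 * ((k / 2 : ℤ) : ℝ) + 2 := by exact_mod_cast h3
  apply Set.Icc_subset_Icc
  · rw [hz]; nlinarith
  · rw [hz]; nlinarith

theorem measurableSet_cell (j k : ℤ) : MeasurableSet (cell j k) := measurableSet_Ico

theorem volume_cell (j k : ℤ) : volume (cell j k) = ENNReal.ofReal (2 ^ j) := by
  rw [cell, Real.volume_Ico]; congr 1; ring

theorem lintegral_eq_tsum_cell (j : ℤ) (F : ℝ → ℝ≥0∞) :
    ∫⁻ x, F x = ∑' k : ℤ, ∫⁻ x in cell j k, F x := by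
  have hU : (⋃ k : ℤ, cell j k) = Set.univ :=
    Set.eq_univ_of_forall fun x => Set.mem_iUnion.2 ⟨_, mem_cell_idx j x⟩
  rw [← lintegral_iUnion (fun k => measurableSet_cell j k), hU, setLIntegral_univ]
  intro a b hab
  refine Set.disjoint_left.2 fun x ha hb => hab ?_
  rw [← mem_cell_iff.1 ha, ← mem_cell_iff.1 hb]

/-- The points whose closed dyadic interval of length `2 ^ j` lies in `{f > 2 ^ j}`. -/
def good (f : ℝ → ℝ) (j : ℤ) : Set ℝ := {x | ∀ t ∈ dyadic j (idx j x), 2 ^ j < f t}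

theorem good_succ_subset (f : ℝ → ℝ) (j : ℤ) : good f (j + 1) ⊆ good f j := by
  intro x hx t ht
  rw [good, Set.mem_ofPred_eq, idx_succ] at hx
  exact lt_of_le_of_lt (zpow_le_zpow_right₀ (by norm_num) (by lia))
    (hx t (dyadic_subset_parent _ _ ht))

theorem good_antitone (f : ℝ → ℝ) : Antitone (good f) :=
  antitone_int_of_succ_le (good_succ_subset f)

/-- The points whose largest good dyadic interval has length `2 ^ j`. -/
def maxGood (f : ℝ → ℝ) (j : ℤ) : Set ℝ := good f j \ good f (j + 1)

theorem maxGood_disjoint (f : ℝ → ℝ) {i j : ℤ} (hij : i ≠ j) :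
    Disjoint (maxGood f i) (maxGood f j) := by
  refine Set.disjoint_left.2 fun x hi hj => ?_
  rcases lt_or_gt_of_ne hij with h | h
  · exact hi.2 (good_antitone f (by lia : i + 1 ≤ j) hj.1)
  · exact hj.2 (good_antitone f (by lia : j + 1 ≤ i) hi.1)

/-! ### Energy and oscillation estimates on a single slice. -/

/-- Every dyadic interval over which the film has at least the height of its length carries at
least `c` times its squared length of energy. -/
def CellEnergyBound (c : ℝ≥0∞) (f : ℝ → ℝ) (κ : ℝ → ℝ≥0∞) : Prop :=
  ∀ j k : ℤ, (∀ t ∈ dyadic j k, 2 ^ j < f t) →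
    c * (ENNReal.ofReal (2 ^ j) * ENNReal.ofReal (2 ^ j)) ≤ ∫⁻ x in cell j k, κ x

/-- The oscillation of `f` on dyadic intervals is bounded by the integral of `δ`. -/
def CellOscBound (f : ℝ → ℝ) (δ : ℝ → ℝ≥0∞) : Prop :=
  ∀ j k : ℤ, ∀ s ∈ dyadic j k, ∀ t ∈ dyadic j k,
    ENNReal.ofReal (f s - f t) ≤ ∫⁻ x in dyadic j k, δ x

/-- By `hsat` the set `A` is a union of cells of length `2^j`; each contributes length `2^j` on the
left and energy at least `c · 4^j` on the right. -/
theorem CellEnergyBound.indicator_le {c : ℝ≥0∞} {f : ℝ → ℝ} {κ : ℝ → ℝ≥0∞}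
    (h : CellEnergyBound c f κ) {j : ℤ} {A : Set ℝ} (hA : A ⊆ good f j)
    (hsat : ∀ x ∈ A, ∀ y, idx j y = idx j x → y ∈ A) :
    c * ENNReal.ofReal (2 ^ j) * ∫⁻ x, A.indicator 1 x ≤ ∫⁻ x, A.indicator κ x := by
  rw [lintegral_eq_tsum_cell j, lintegral_eq_tsum_cell j, ← ENNReal.tsum_mul_left]
  refine ENNReal.tsum_le_tsum fun k => ?_
  by_cases hk : ∃ x ∈ A, idx j x = k
  · obtain ⟨x, hxA, rfl⟩ := hk
    have hsub : ∀ y ∈ cell j (idx j x), y ∈ A := fun y hy => hsat x hxA y (mem_cell_iff.1 hy)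
    rw [setLIntegral_congr_fun (measurableSet_cell _ _)
      (fun y hy => Set.indicator_of_mem (hsub y hy) _),
      setLIntegral_congr_fun (g := κ) (measurableSet_cell _ _)
      (fun y hy => Set.indicator_of_mem (hsub y hy) _)]
    simp only [Pi.one_apply, setLIntegral_one, volume_cell]
    rw [mul_assoc]
    exact h j _ (hA hxA)
  · push Not at hk
    rw [setLIntegral_congr_fun (g := fun _ => 0) (measurableSet_cell _ _)
      (fun y hy => Set.indicator_of_notMem (fun hyA => hk y hyA (mem_cell_iff.1 hy)) _)]
    simp

theorem good_saturated (f : ℝ → ℝ) {j : ℤ} {x y : ℝ} (hxy : idx j y = idx j x) :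
    y ∈ good f j ↔ x ∈ good f j := by
  rw [good, Set.mem_ofPred_eq, Set.mem_ofPred_eq, hxy]

theorem maxGood_saturated (f : ℝ → ℝ) {j : ℤ} {x y : ℝ} (hxy : idx j y = idx j x) :
    y ∈ maxGood f j ↔ x ∈ maxGood f j := by
  have hxy' : idx (j + 1) y = idx (j + 1) x := by rw [idx_succ, idx_succ, hxy]
  rw [maxGood, Set.mem_sdiff, Set.mem_sdiff, good_saturated f hxy, good_saturated f hxy']

theorem CellEnergyBound.good_le {c : ℝ≥0∞} {f : ℝ → ℝ} {κ : ℝ → ℝ≥0∞}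
    (h : CellEnergyBound c f κ) (j : ℤ) :
    c * ENNReal.ofReal (2 ^ j) * ∫⁻ x, (good f j).indicator 1 x ≤ ∫⁻ x, κ x :=
  (h.indicator_le subset_rfl fun _ hx _ hxy => (good_saturated f hxy).2 hx).trans
    (lintegral_mono fun _ => Set.indicator_le_self _ _ _)

theorem CellEnergyBound.maxGood_le {c : ℝ≥0∞} {f : ℝ → ℝ} {κ : ℝ → ℝ≥0∞}
    (h : CellEnergyBound c f κ) (j : ℤ) :
    c * ENNReal.ofReal (2 ^ j) * ∫⁻ x, (maxGood f j).indicator 1 x ≤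
      ∫⁻ x, (maxGood f j).indicator κ x :=
  h.indicator_le Set.sdiff_subset fun _ hx _ hxy => (maxGood_saturated f hxy).2 hx

theorem CellEnergyBound.nonempty_le {c : ℝ≥0∞} {f : ℝ → ℝ} {κ : ℝ → ℝ≥0∞}
    (h : CellEnergyBound c f κ) {j : ℤ} (hne : (good f j).Nonempty) :
    c * (ENNReal.ofReal (2 ^ j) * ENNReal.ofReal (2 ^ j)) ≤ ∫⁻ x, κ x := by
  obtain ⟨x, hx⟩ := hne
  exact (h j _ hx).trans (setLIntegral_le_lintegral _ _)

theorem exists_mem_good {f : ℝ → ℝ} (hf : Continuous f) {x : ℝ} (hx : 0 < f x) :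
    ∃ j, x ∈ good f j := by
  obtain ⟨ε, hε, hball⟩ := Metric.continuousAt_iff.1 hf.continuousAt (f x / 2) (by positivity)
  obtain ⟨n, hn⟩ := exists_pow_lt_of_lt_one (lt_min hε (half_pos hx))
    (by norm_num : (1 / 2 : ℝ) < 1)
  have hj : (2 : ℝ) ^ (-(n : ℤ)) < min ε (f x / 2) := by
    rwa [zpow_neg, zpow_natCast, ← one_div, ← one_div_pow]
  refine ⟨-n, fun t ht => ?_⟩
  have hx' := mem_dyadic_idx (-n) x
  rw [dyadic, Set.mem_Icc] at ht hx'
  have hd : dist t x < ε := by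
    rw [Real.dist_eq, abs_lt]
    have := lt_min_iff.1 hj
    constructor <;> nlinarith
  have := hball hd
  rw [Real.dist_eq, abs_lt] at this
  have := lt_min_iff.1 hj
  linarith

theorem CellEnergyBound.exists_mem_maxGood {c : ℝ≥0∞} (hc : c ≠ 0) {f : ℝ → ℝ} {κ : ℝ → ℝ≥0∞}
    (h : CellEnergyBound c f κ) (hf : Continuous f) (hκ : ∫⁻ x, κ x ≠ ⊤) {x : ℝ} (hx : 0 < f x) :
    ∃ j, x ∈ maxGood f j := by
  -- A good interval of length `2^j` costs `c · 4^j`, so finite energy bounds the good scales; by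
  -- `exists_mem_good` there is at least one, hence a largest.
  have hbdd : ∃ b : ℤ, ∀ j, x ∈ good f j → j ≤ b := by
    have hfin : (∫⁻ x, κ x) / c ≠ ⊤ := ENNReal.div_ne_top hκ hc
    obtain ⟨n, hn⟩ := pow_unbounded_of_one_lt ((∫⁻ x, κ x) / c).toReal
      (by norm_num : (1 : ℝ) < 2)
    refine ⟨n, fun j hj => ?_⟩
    by_contra! hlt
    have hn1 : (2 : ℝ) ^ n ≤ 2 ^ j := by
      rw [← zpow_natCast]; exact zpow_le_zpow_right₀ (by norm_num) hlt.le
    have h1 : (1 : ℝ) ≤ 2 ^ n := one_le_pow₀ (by norm_num)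
    have hb := h.nonempty_le ⟨x, hj⟩
    by_cases hct : c = ⊤
    · rw [hct, ENNReal.top_mul] at hb
      · exact hκ (top_le_iff.1 hb)
      · rw [← ENNReal.ofReal_mul (by positivity)]
        exact (ENNReal.ofReal_pos.2 (by positivity)).ne'
    rw [mul_comm, ← ENNReal.le_div_iff_mul_le (Or.inl hc) (Or.inl hct),
      ← ENNReal.ofReal_mul (by positivity), ENNReal.ofReal_le_iff_le_toReal hfin] at hb
    nlinarith
  obtain ⟨b, hb, hmax⟩ := Int.exists_greatest_of_bdd hbdd (exists_mem_good hf hx)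
  exact ⟨b, hb, fun h' => by have := hmax _ h'; lia⟩

theorem sq_lintegral_le {α : Type*} [MeasureSpace α] (s : Set α) {δ : α → ℝ≥0∞}
    (hδ : AEMeasurable δ) :
    (∫⁻ x in s, δ x) ^ 2 ≤ volume s * ∫⁻ x in s, δ x ^ 2 := by
  have h := ENNReal.lintegral_mul_le_Lp_mul_Lq (volume.restrict s) Real.HolderConjugate.two_two
    (f := fun _ => 1) (g := δ) aemeasurable_const hδ.restrict
  simp only [Pi.mul_apply, one_mul, ENNReal.one_rpow, lintegral_const, MeasurableSet.univ,
    Measure.restrict_apply, Set.univ_inter] at h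
  have h' := ENNReal.rpow_le_rpow h (by norm_num : (0 : ℝ) ≤ 2)
  rw [ENNReal.mul_rpow_of_nonneg _ _ (by norm_num), ← ENNReal.rpow_mul, ← ENNReal.rpow_mul] at h'
  norm_num at h'
  exact h'

/-- The part of `maxGood f j` where `f` is large compared to `2 ^ j`. -/
def tall (f : ℝ → ℝ) (j : ℤ) : Set ℝ := maxGood f j ∩ {x | 8 * 2 ^ j < f x}

/-- The part of `maxGood f j` where `f` is at most comparable to `2 ^ j`. -/
def low (f : ℝ → ℝ) (j : ℤ) : Set ℝ := maxGood f j ∩ {x | f x ≤ 8 * 2 ^ j}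

/-- The parent interval fails to be good at some `t`, where `f t ≤ 2^(j+1) < f x / 2`. Hence `f x ≤
2 ∫ δ` over the parent, and Cauchy–Schwarz bounds `f x ^ 2` by `4 · 2^(j+1) ∫ δ²`. Integrating this
constant over the parent costs another `2^(j+1)`, whence `16 · 4^j`. -/
theorem CellOscBound.tall_le {f : ℝ → ℝ} {δ : ℝ → ℝ≥0∞} (h : CellOscBound f δ)
    (hδ : AEMeasurable δ) (j : ℤ) :
    ∫⁻ x, (tall f j).indicator (fun x => ENNReal.ofReal (f x) ^ 2) x ≤
      16 * (ENNReal.ofReal (2 ^ j) * ENNReal.ofReal (2 ^ j)) * ∫⁻ x, δ x ^ 2 := by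
  have hz : (2 : ℝ) ^ (j + 1) = 2 * 2 ^ j := by
    rw [zpow_add₀ (by norm_num), zpow_one, mul_comm]
  have hr : ENNReal.ofReal (2 ^ (j + 1)) = 2 * ENNReal.ofReal (2 ^ j) := by
    rw [hz, ENNReal.ofReal_mul (by norm_num), ENNReal.ofReal_ofNat]
  have h2 : (0 : ℝ) < 2 ^ j := by positivity
  rw [lintegral_eq_tsum_cell (j + 1), lintegral_eq_tsum_cell (j + 1) fun x => δ x ^ 2,
    ← ENNReal.tsum_mul_left]
  refine ENNReal.tsum_le_tsum fun k => ?_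
  have hpt : ∀ x ∈ cell (j + 1) k, (tall f j).indicator (fun x => ENNReal.ofReal (f x) ^ 2) x ≤
      4 * (ENNReal.ofReal (2 ^ (j + 1)) * ∫⁻ x in cell (j + 1) k, δ x ^ 2) := by
    intro x hx
    by_cases hxt : x ∈ tall f j
    swap
    · rw [Set.indicator_of_notMem hxt]; exact zero_le
    rw [Set.indicator_of_mem hxt]
    have hng := hxt.1.2
    rw [good, Set.mem_ofPred_eq, mem_cell_iff.1 hx] at hng
    push Not at hng
    obtain ⟨t, ht, hft⟩ := hng
    have hosc := h (j + 1) k x (cell_subset_dyadic _ _ hx) t ht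
    have hfx : 8 * 2 ^ j < f x := hxt.2
    rw [show (∫⁻ x in dyadic (j + 1) k, δ x) = ∫⁻ x in cell (j + 1) k, δ x from
      setLIntegral_congr Ico_ae_eq_Icc.symm] at hosc
    calc ENNReal.ofReal (f x) ^ 2 ≤ (2 * ∫⁻ x in cell (j + 1) k, δ x) ^ 2 := by
          gcongr
          calc ENNReal.ofReal (f x) ≤ ENNReal.ofReal (2 * (f x - f t)) := by
                apply ENNReal.ofReal_le_ofReal; linarith
            _ = 2 * ENNReal.ofReal (f x - f t) := by
                rw [ENNReal.ofReal_mul (by norm_num), ENNReal.ofReal_ofNat]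
            _ ≤ _ := by gcongr
      _ = 4 * (∫⁻ x in cell (j + 1) k, δ x) ^ 2 := by rw [mul_pow]; norm_num
      _ ≤ _ := by
          gcongr
          exact (sq_lintegral_le _ hδ).trans_eq (by rw [volume_cell])
  calc _ ≤ ∫⁻ x in cell (j + 1) k, 4 * (ENNReal.ofReal (2 ^ (j + 1)) *
          ∫⁻ x in cell (j + 1) k, δ x ^ 2) := setLIntegral_mono' (measurableSet_cell _ _) hpt
    _ = _ := by
      rw [setLIntegral_const, volume_cell, hr]; ring

/-- The energy per unit length on a good cell is at least `c · 2^j`, which is comparable to the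
height here. -/
theorem CellEnergyBound.low_le {c : ℝ≥0∞} {f : ℝ → ℝ} {κ : ℝ → ℝ≥0∞}
    (h : CellEnergyBound c f κ) (j : ℤ) :
    c * ∫⁻ x, (low f j).indicator (fun x => ENNReal.ofReal (f x)) x ≤
      8 * ∫⁻ x, (maxGood f j).indicator κ x := by
  have h1 : ∫⁻ x, (low f j).indicator (fun x => ENNReal.ofReal (f x)) x ≤
      8 * ENNReal.ofReal (2 ^ j) * ∫⁻ x, (maxGood f j).indicator 1 x := by
    rw [← lintegral_const_mul' _ _ (by finiteness)]
    refine lintegral_mono fun x => ?_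
    by_cases hx : x ∈ low f j
    · rw [Set.indicator_of_mem hx, Set.indicator_of_mem hx.1, Pi.one_apply, mul_one]
      calc _ ≤ ENNReal.ofReal (8 * 2 ^ j) := ENNReal.ofReal_le_ofReal hx.2
        _ = _ := by rw [ENNReal.ofReal_mul (by norm_num), ENNReal.ofReal_ofNat]
    · rw [Set.indicator_of_notMem hx]; exact zero_le
  calc _ ≤ c * (8 * ENNReal.ofReal (2 ^ j) * ∫⁻ x, (maxGood f j).indicator 1 x) := by gcongr
    _ = 8 * (c * ENNReal.ofReal (2 ^ j) * ∫⁻ x, (maxGood f j).indicator 1 x) := by ring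
    _ ≤ _ := by gcongr; exact h.maxGood_le j

/-! ### From slices to the plane. -/

/-- The points of the plane that are good at scale `2 ^ j` in the slice in direction `x`. -/
def goodSet (h : Plane → ℝ) (j : ℤ) : Set Plane := {p | p.1 ∈ good (fun x => h (x, p.2)) j}

/-- The points of the plane whose largest good interval in direction `x` has length `2 ^ j`. -/
def maxGoodSet (h : Plane → ℝ) (j : ℤ) : Set Plane := goodSet h j \ goodSet h (j + 1)

/-- The part of `maxGoodSet h j` where `h` is large compared to `2 ^ j`. -/
def tallSet (h : Plane → ℝ) (j : ℤ) : Set Plane := maxGoodSet h j ∩ {p | 8 * 2 ^ j < h p}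

/-- The part of `maxGoodSet h j` where `h` is at most comparable to `2 ^ j`. -/
def lowSet (h : Plane → ℝ) (j : ℤ) : Set Plane := maxGoodSet h j ∩ {p | h p ≤ 8 * 2 ^ j}

/-- The ordinates for which the dyadic interval of length `2 ^ j` and index `k` is good. -/
def goodOrdinates (h : Plane → ℝ) (j k : ℤ) : Set ℝ := {y | ∀ t ∈ dyadic j k, 2 ^ j < h (t, y)}

/-- This rests on compactness of the closed dyadic interval. Openness gives measurability here, and
later room for test functions in `y` supported over good ordinates. -/
theorem isOpen_goodOrdinates {h : Plane → ℝ} (hh : Continuous h) (j k : ℤ) :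
    IsOpen (goodOrdinates h j k) := by
  rw [isOpen_iff_eventually]
  intro y hy
  refine (isCompact_Icc : IsCompact (dyadic j k)).eventually_forall_of_forall_eventually
    fun t ht => ?_
  have : Continuous fun z : ℝ × ℝ => h (z.2, z.1) := hh.comp continuous_swap
  exact (isOpen_lt continuous_const this).mem_nhds (hy t ht)

theorem goodSet_eq (h : Plane → ℝ) (j : ℤ) :
    goodSet h j = ⋃ k, cell j k ×ˢ goodOrdinates h j k := by
  ext p
  simp only [Set.mem_iUnion, Set.mem_prod, mem_cell_iff]
  constructor
  · exact fun hp => ⟨_, rfl, hp⟩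
  · rintro ⟨k, rfl, hp⟩
    exact hp

theorem measurableSet_goodSet {h : Plane → ℝ} (hh : Continuous h) (j : ℤ) :
    MeasurableSet (goodSet h j) := by
  rw [goodSet_eq]
  exact MeasurableSet.iUnion fun k =>
    (measurableSet_cell j k).prod (isOpen_goodOrdinates hh j k).measurableSet

theorem measurableSet_maxGoodSet {h : Plane → ℝ} (hh : Continuous h) (j : ℤ) :
    MeasurableSet (maxGoodSet h j) :=
  (measurableSet_goodSet hh j).diff (measurableSet_goodSet hh (j + 1))

theorem measurableSet_tallSet {h : Plane → ℝ} (hh : Continuous h) (j : ℤ) :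
    MeasurableSet (tallSet h j) :=
  (measurableSet_maxGoodSet hh j).inter (measurableSet_lt measurable_const hh.measurable)

theorem measurableSet_lowSet {h : Plane → ℝ} (hh : Continuous h) (j : ℤ) :
    MeasurableSet (lowSet h j) :=
  (measurableSet_maxGoodSet hh j).inter (measurableSet_le hh.measurable measurable_const)

/-- The bounds on almost all slices in direction `x` that enter the lower bound for the energy:
`κ` is the elastic energy per unit area and `δ` is the slope of the profile in direction `x`. -/
structure SliceBounds (c : ℝ≥0∞) (h : Plane → ℝ) (κ δ : Plane → ℝ≥0∞) : Prop where
  continuous : Continuous h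
  aemeasurable_energy : AEMeasurable κ
  aemeasurable_slope : AEMeasurable δ
  energy_bound : ∀ᵐ y : ℝ, CellEnergyBound c (fun x => h (x, y)) fun x => κ (x, y)
  osc_bound : ∀ᵐ y : ℝ, CellOscBound (fun x => h (x, y)) fun x => δ (x, y)

namespace SliceBounds

variable {c : ℝ≥0∞} {h : Plane → ℝ} {κ δ : Plane → ℝ≥0∞}

theorem aemeasurable_slice {F : Plane → ℝ≥0∞} (hF : AEMeasurable F) :
    ∀ᵐ y : ℝ, AEMeasurable fun x => F (x, y) := by
  have hF' : AEMeasurable (fun z : ℝ × ℝ => F z.swap) (volume.prod volume) :=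
    hF.comp_quasiMeasurePreserving Measure.measurePreserving_swap.quasiMeasurePreserving
  filter_upwards [Measure.ae_ae_of_ae_prod hF'.ae_eq_mk] with y hy
  exact ⟨fun x => hF'.mk _ (y, x), hF'.measurable_mk.comp measurable_prodMk_left, hy⟩

theorem lintegral_slices {F : Plane → ℝ≥0∞} (hF : AEMeasurable F) :
    ∫⁻ p, F p = ∫⁻ y : ℝ, ∫⁻ x : ℝ, F (x, y) :=
  lintegral_prod_symm F hF

theorem aemeasurable_slice_lintegral {F : Plane → ℝ≥0∞} (hF : AEMeasurable F) :
    AEMeasurable fun y : ℝ => ∫⁻ x : ℝ, F (x, y) := by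
  have hF' : AEMeasurable (fun z : ℝ × ℝ => F z.swap) (volume.prod volume) :=
    hF.comp_quasiMeasurePreserving Measure.measurePreserving_swap.quasiMeasurePreserving
  exact hF'.lintegral_prod_right'

theorem volume_goodSet_le (H : SliceBounds c h κ δ) (hc : c ≠ ⊤) (j : ℤ) :
    c * ENNReal.ofReal (2 ^ j) * volume (goodSet h j) ≤ ∫⁻ p, κ p := by
  have hm := measurableSet_goodSet H.continuous j
  rw [← lintegral_indicator_one hm, lintegral_slices H.aemeasurable_energy,
    lintegral_slices ((measurable_one.indicator hm).aemeasurable),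
    ← lintegral_const_mul' _ _ (by finiteness)]
  exact lintegral_mono_ae (H.energy_bound.mono fun y hy => hy.good_le j)

/-- A single good interval on a line already forces energy `c · 4^j` on that line. -/
theorem volume_ordinates_le (H : SliceBounds c h κ δ) (j : ℤ) :
    c * (ENNReal.ofReal (2 ^ j) * ENNReal.ofReal (2 ^ j)) * volume (⋃ k, goodOrdinates h j k) ≤
      ∫⁻ p, κ p := by
  have hm : MeasurableSet (⋃ k, goodOrdinates h j k) :=
    (isOpen_iUnion fun k => isOpen_goodOrdinates H.continuous j k).measurableSet
  rw [← lintegral_indicator_one hm, lintegral_slices H.aemeasurable_energy,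
    ← lintegral_const_mul _ (measurable_one.indicator hm)]
  refine lintegral_mono_ae (H.energy_bound.mono fun y hy => ?_)
  by_cases hy' : y ∈ ⋃ k, goodOrdinates h j k
  · rw [Set.indicator_of_mem hy', Pi.one_apply, mul_one]
    obtain ⟨k, hk⟩ := Set.mem_iUnion.1 hy'
    exact (hy j k hk).trans (setLIntegral_le_lintegral _ _)
  · rw [Set.indicator_of_notMem hy', mul_zero]; exact zero_le

theorem lintegral_tallSet_le (H : SliceBounds c h κ δ) (j : ℤ) :
    ∫⁻ p in tallSet h j, ENNReal.ofReal (h p) ^ 2 ≤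
      16 * (ENNReal.ofReal (2 ^ j) * ENNReal.ofReal (2 ^ j)) * ∫⁻ p, δ p ^ 2 := by
  have hm := measurableSet_tallSet H.continuous j
  have hF : Measurable fun p => ENNReal.ofReal (h p) ^ 2 :=
    H.continuous.measurable.ennreal_ofReal.pow_const 2
  rw [← lintegral_indicator hm, lintegral_slices (hF.indicator hm).aemeasurable,
    lintegral_slices (H.aemeasurable_slope.pow_const 2),
    ← lintegral_const_mul' _ _ (by finiteness)]
  refine lintegral_mono_ae ?_
  filter_upwards [H.osc_bound, aemeasurable_slice H.aemeasurable_slope] with y hy hm'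
  exact hy.tall_le hm' j

theorem lintegral_lowSet_le (H : SliceBounds c h κ δ) (hc : c ≠ ⊤) (j : ℤ) :
    c * ∫⁻ p in lowSet h j, ENNReal.ofReal (h p) ≤ 8 * ∫⁻ p in maxGoodSet h j, κ p := by
  have hm := measurableSet_lowSet H.continuous j
  have hm' := measurableSet_maxGoodSet H.continuous j
  have hF : Measurable fun p => ENNReal.ofReal (h p) := H.continuous.measurable.ennreal_ofReal
  rw [← lintegral_indicator hm, ← lintegral_indicator hm',
    lintegral_slices (hF.indicator hm).aemeasurable,
    lintegral_slices (H.aemeasurable_energy.indicator hm'),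
    ← lintegral_const_mul' _ _ hc, ← lintegral_const_mul' _ _ (by finiteness)]
  exact lintegral_mono_ae (H.energy_bound.mono fun y hy => hy.low_le j)

/-- The sets `maxGoodSet h j` are disjoint for different `j`, so summing over scales counts the
energy only once. -/
theorem lintegral_iUnion_lowSet_le (H : SliceBounds c h κ δ) (hc : c ≠ ⊤) :
    c * ∫⁻ p in ⋃ j, lowSet h j, ENNReal.ofReal (h p) ≤ 8 * ∫⁻ p, κ p := by
  calc c * ∫⁻ p in ⋃ j, lowSet h j, ENNReal.ofReal (h p)
      ≤ c * ∑' j, ∫⁻ p in lowSet h j, ENNReal.ofReal (h p) := by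
        gcongr; exact lintegral_iUnion_le _ _
    _ = ∑' j, c * ∫⁻ p in lowSet h j, ENNReal.ofReal (h p) := ENNReal.tsum_mul_left.symm
    _ ≤ ∑' j, 8 * ∫⁻ p in maxGoodSet h j, κ p :=
        ENNReal.tsum_le_tsum fun j => H.lintegral_lowSet_le hc j
    _ = 8 * ∑' j, ∫⁻ p in maxGoodSet h j, κ p := ENNReal.tsum_mul_left
    _ = 8 * ∫⁻ p in ⋃ j, maxGoodSet h j, κ p := by
        rw [lintegral_iUnion (measurableSet_maxGoodSet H.continuous)]
        intro i j hij
        refine Set.disjoint_left.2 fun p hi hj => ?_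
        exact Set.disjoint_left.1 (maxGood_disjoint (fun x => h (x, p.2)) hij)
          (show p.1 ∈ _ from hi) hj
    _ ≤ _ := by gcongr; exact Measure.restrict_le_self

theorem ae_exists_mem_maxGoodSet (H : SliceBounds c h κ δ) (hc : c ≠ 0)
    (hκ : ∫⁻ p, κ p ≠ ⊤) : ∀ᵐ p : Plane, 0 < h p → ∃ j, p ∈ maxGoodSet h j := by
  have hm : MeasurableSet {p : Plane | 0 < h p → ∃ j, p ∈ maxGoodSet h j} := by
    have : {p : Plane | 0 < h p → ∃ j, p ∈ maxGoodSet h j} =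
        {p | 0 < h p}ᶜ ∪ ⋃ j, maxGoodSet h j := by
      ext p; simp [imp_iff_not_or]
    rw [this]
    exact (measurableSet_lt measurable_const H.continuous.measurable).compl.union
      (MeasurableSet.iUnion (measurableSet_maxGoodSet H.continuous))
  have hswap : ∀ᵐ z : ℝ × ℝ, 0 < h z.swap → ∃ j, z.swap ∈ maxGoodSet h j := by
    refine (Measure.ae_prod_iff_ae_ae (measurable_swap hm)).2 ?_
    have hfin := ae_lt_top' (aemeasurable_slice_lintegral H.aemeasurable_energy)
      (by rwa [← lintegral_slices H.aemeasurable_energy])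
    filter_upwards [hfin, H.energy_bound] with y hy hb
    exact Filter.Eventually.of_forall fun x hx =>
      hb.exists_mem_maxGood hc (H.continuous.comp (by fun_prop)) hy.ne hx
  have := (Measure.measurePreserving_swap (μ := (volume : Measure ℝ))
    (ν := (volume : Measure ℝ))).quasiMeasurePreserving.ae hswap
  filter_upwards [this] with p hp using by simpa using hp

end SliceBounds

/-! ### Summation over the scales and the volume bound. -/

/-- With `t ^ 3` in the role of the elastic energy, the two entries of the minimum yield `t³ 2^j`
and `t⁶ 4^(-j)`, which balance at `2^j ~ t`; `n` satisfies `2^n ≤ t < 2^(n+1)`. The decay is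
`(1/2)^m` below `n` and `(1/4)^m` above; both are at most `(9/16)^m`, chosen for its rational square
root `(3/4)^m`, which is summed later. -/
theorem exists_scale_bound {c t : ℝ} (hc : 0 < c) (ht : 0 ≤ t) : ∃ n : ℤ, ∀ j : ℤ,
    min (t ^ 3 / (c * 2 ^ j)) (t ^ 3 / (c * (2 ^ j * 2 ^ j)) * (t ^ 3 / (c * (2 ^ j * 2 ^ j)))) *
      (16 * (2 ^ j * 2 ^ j)) ≤
      16 * (1 / c + 4 / c ^ 2) * t ^ 4 * ((3 / 4 : ℝ) ^ (j - n).natAbs) ^ 2 := by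
  rcases ht.eq_or_lt with rfl | ht
  · exact ⟨0, fun j => by simp⟩
  obtain ⟨n, hn1, hn2⟩ := exists_mem_Ico_zpow (y := (2 : ℝ)) ht (by norm_num)
  have h2 : (0 : ℝ) < 2 ^ n := by positivity
  refine ⟨n, fun j => ?_⟩
  have ha : (0 : ℝ) < 2 ^ j := by positivity
  have hq (m : ℕ) : ((3 / 4 : ℝ) ^ m) ^ 2 = (9 / 16) ^ m := by
    rw [← pow_mul, mul_comm, pow_mul]; norm_num
  rw [hq]
  rcases le_total j n with hj | hj
  · obtain ⟨m, hm⟩ := Int.eq_ofNat_of_zero_le (sub_nonneg.2 hj)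
    have hm' : (j - n).natAbs = m := by lia
    have haj : (2 : ℝ) ^ j ≤ t * (1 / 2) ^ m := by
      rw [show j = n - m by lia, zpow_sub₀ (by norm_num), zpow_natCast, one_div, inv_pow,
        ← div_eq_mul_inv]
      gcongr
    have hpow : (1 / 2 : ℝ) ^ m ≤ (9 / 16) ^ m :=
      pow_le_pow_left₀ (by norm_num) (by norm_num) m
    rw [hm']
    calc _ ≤ (t ^ 3 / (c * 2 ^ j)) * (16 * (2 ^ j * 2 ^ j)) := by gcongr; exact min_le_left _ _
      _ = 16 * (1 / c) * t ^ 3 * 2 ^ j := by field_simp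
      _ ≤ 16 * (1 / c) * t ^ 3 * (t * (1 / 2) ^ m) := by gcongr
      _ ≤ 16 * (1 / c) * t ^ 3 * (t * (9 / 16) ^ m) := by gcongr
      _ = 16 * (1 / c + 0) * t ^ 4 * (9 / 16) ^ m := by ring
      _ ≤ _ := by gcongr; positivity
  · obtain ⟨m, hm⟩ := Int.eq_ofNat_of_zero_le (sub_nonneg.2 hj)
    have hm' : (j - n).natAbs = m := by lia
    have haj : t / 2 * 2 ^ m ≤ (2 : ℝ) ^ j := by
      rw [show j = n + m by lia, zpow_add₀ (by norm_num), zpow_natCast]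
      rw [zpow_add₀ (by norm_num), zpow_one] at hn2
      gcongr; linarith
    have hpow : (1 / 4 : ℝ) ^ m ≤ (9 / 16) ^ m :=
      pow_le_pow_left₀ (by norm_num) (by norm_num) m
    rw [hm']
    calc _ ≤ (t ^ 3 / (c * (2 ^ j * 2 ^ j)) * (t ^ 3 / (c * (2 ^ j * 2 ^ j)))) *
          (16 * (2 ^ j * 2 ^ j)) := by gcongr; exact min_le_right _ _
      _ = 16 / c ^ 2 * t ^ 6 / (2 ^ j) ^ 2 := by field_simp
      _ ≤ 16 / c ^ 2 * t ^ 6 / (t / 2 * 2 ^ m) ^ 2 := by gcongr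
      _ = 16 * (4 / c ^ 2) * t ^ 4 * (1 / 4) ^ m := by
        rw [one_div, inv_pow, show (4 : ℝ) = 2 ^ 2 by norm_num, ← pow_mul, mul_comm 2 m, pow_mul]
        field_simp
      _ ≤ 16 * (4 / c ^ 2) * t ^ 4 * (9 / 16) ^ m := by gcongr
      _ = 16 * (0 + 4 / c ^ 2) * t ^ 4 * (9 / 16) ^ m := by ring
      _ ≤ _ := by gcongr; positivity

theorem summable_pow_natAbs : Summable fun j : ℤ => (3 / 4 : ℝ) ^ j.natAbs := by
  rw [summable_int_iff_summable_nat_and_neg]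
  constructor <;> simpa using summable_geometric_of_lt_one (r := (3 / 4 : ℝ)) (by norm_num)
    (by norm_num)

theorem tsum_pow_natAbs_sub (n : ℤ) :
    ∑' j : ℤ, ENNReal.ofReal ((3 / 4) ^ (j - n).natAbs) =
      ENNReal.ofReal (∑' j : ℤ, (3 / 4 : ℝ) ^ j.natAbs) := by
  rw [ENNReal.ofReal_tsum_of_nonneg (fun _ => by positivity) summable_pow_natAbs]
  exact (Equiv.subRight n).tsum_eq fun j : ℤ => ENNReal.ofReal ((3 / 4) ^ j.natAbs)

namespace SliceBounds

variable {c : ℝ} {h : Plane → ℝ} {κ δ₁ δ₂ : Plane → ℝ≥0∞}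

/-- The part of `tallSet h j` that is good at scale `2 ^ j` in both directions. -/
def crossSet (h : Plane → ℝ) (j : ℤ) : Set Plane :=
  tallSet h j ∩ Prod.swap ⁻¹' goodSet (h ∘ Prod.swap) j

/-- Being good in direction `x` bounds the area by summation over cells. Being good in both
directions also places the set in a product of good abscissae and good ordinates, each of length at
most `k / (c · 4^j)`; this second bound is what makes the sum over large scales converge. -/
theorem volume_crossSet_le (hc : 0 < c)
    (H₁ : SliceBounds (ENNReal.ofReal c) h κ δ₁)
    (H₂ : SliceBounds (ENNReal.ofReal c) (h ∘ Prod.swap) (κ ∘ Prod.swap) δ₂)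
    {k : ℝ} (hk0 : 0 ≤ k) (hk : ∫⁻ p, κ p = ENNReal.ofReal k)
    (hk' : ∫⁻ p, (κ ∘ Prod.swap) p = ENNReal.ofReal k) (j : ℤ) :
    volume (crossSet h j) ≤ ENNReal.ofReal (min (k / (c * 2 ^ j))
      (k / (c * (2 ^ j * 2 ^ j)) * (k / (c * (2 ^ j * 2 ^ j))))) := by
  have h2 : (0 : ℝ) < 2 ^ j := by positivity
  have key {a : ℝ} (ha : 0 < a) {x : ℝ≥0∞} (hx : ENNReal.ofReal a * x ≤ ENNReal.ofReal k) :
      x ≤ ENNReal.ofReal (k / a) := by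
    rw [ENNReal.ofReal_div_of_pos ha, ENNReal.le_div_iff_mul_le, mul_comm]
    · exact hx
    · exact Or.inl (ENNReal.ofReal_pos.2 ha).ne'
    · exact Or.inl ENNReal.ofReal_ne_top
  have hsub : crossSet h j ⊆ goodSet h j := fun p hp => hp.1.1.1
  have hsub' : crossSet h j ⊆ (⋃ k, goodOrdinates (h ∘ Prod.swap) j k) ×ˢ
      (⋃ k, goodOrdinates h j k) := by
    intro p hp
    have h1 := hsub hp
    have h2 : p.swap ∈ goodSet (h ∘ Prod.swap) j := hp.2
    rw [goodSet_eq, Set.mem_iUnion] at h1 h2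
    obtain ⟨k₁, hk₁⟩ := h1
    obtain ⟨k₂, hk₂⟩ := h2
    exact ⟨Set.mem_iUnion.2 ⟨k₂, hk₂.2⟩, Set.mem_iUnion.2 ⟨k₁, hk₁.2⟩⟩
  have b1 := H₁.volume_goodSet_le ENNReal.ofReal_ne_top j
  have b2 := H₁.volume_ordinates_le j
  have b3 := H₂.volume_ordinates_le j
  rw [hk, ← ENNReal.ofReal_mul hc.le] at b1
  rw [hk, ← ENNReal.ofReal_mul h2.le, ← ENNReal.ofReal_mul hc.le] at b2
  rw [hk', ← ENNReal.ofReal_mul h2.le, ← ENNReal.ofReal_mul hc.le] at b3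
  rw [ENNReal.ofReal_min, le_min_iff]
  refine ⟨(measure_mono hsub).trans (key (by positivity) b1), ?_⟩
  refine (measure_mono hsub').trans ?_
  rw [Measure.volume_eq_prod, Measure.prod_prod, ENNReal.ofReal_mul (by positivity)]
  exact mul_le_mul' (key (by positivity) b3) (key (by positivity) b2)

theorem lintegral_iUnion_crossSet_le (hc : 0 < c)
    (H₁ : SliceBounds (ENNReal.ofReal c) h κ δ₁)
    (H₂ : SliceBounds (ENNReal.ofReal c) (h ∘ Prod.swap) (κ ∘ Prod.swap) δ₂)
    {t : ℝ} (ht : 0 ≤ t) (hk : ∫⁻ p, κ p = ENNReal.ofReal (t ^ 3))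
    (hk' : ∫⁻ p, (κ ∘ Prod.swap) p = ENNReal.ofReal (t ^ 3))
    {d : ℝ} (hd : 0 ≤ d) (hD : ∫⁻ p, δ₁ p ^ 2 ≤ ENNReal.ofReal (d ^ 2)) :
    ∫⁻ p in ⋃ j, crossSet h j, ENNReal.ofReal (h p) ≤
      ENNReal.ofReal (√(16 * (1 / c + 4 / c ^ 2)) * (∑' j : ℤ, (3 / 4 : ℝ) ^ j.natAbs) *
        (t ^ 2 * d)) := by
  obtain ⟨n, hn⟩ := exists_scale_bound hc ht
  set B := 16 * (1 / c + 4 / c ^ 2) with hB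
  have hB0 : 0 ≤ B := by positivity
  have hj (j : ℤ) : ∫⁻ p in crossSet h j, ENNReal.ofReal (h p) ≤
      ENNReal.ofReal (√B * (t ^ 2 * d)) * ENNReal.ofReal ((3 / 4) ^ (j - n).natAbs) := by
    have h2 : (0 : ℝ) < 2 ^ j := by positivity
    rw [← ENNReal.ofReal_mul (by positivity), ← ENNReal.pow_le_pow_left_iff (two_ne_zero)]
    -- Cauchy–Schwarz pairs the small area with the `L²` bound from the slope.
    calc _ ≤ volume (crossSet h j) * ∫⁻ p in crossSet h j, ENNReal.ofReal (h p) ^ 2 :=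
          sq_lintegral_le _ H₁.continuous.measurable.ennreal_ofReal.aemeasurable
      _ ≤ volume (crossSet h j) * ∫⁻ p in tallSet h j, ENNReal.ofReal (h p) ^ 2 := by
          gcongr; exact Set.inter_subset_left
      _ ≤ ENNReal.ofReal (min (t ^ 3 / (c * 2 ^ j))
            (t ^ 3 / (c * (2 ^ j * 2 ^ j)) * (t ^ 3 / (c * (2 ^ j * 2 ^ j))))) *
          (16 * (ENNReal.ofReal (2 ^ j) * ENNReal.ofReal (2 ^ j)) * ENNReal.ofReal (d ^ 2)) := by
          gcongr
          · exact volume_crossSet_le hc H₁ H₂ (by positivity) hk hk' j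
          · exact (H₁.lintegral_tallSet_le j).trans (by gcongr)
      _ = ENNReal.ofReal (min (t ^ 3 / (c * 2 ^ j))
            (t ^ 3 / (c * (2 ^ j * 2 ^ j)) * (t ^ 3 / (c * (2 ^ j * 2 ^ j)))) *
            (16 * (2 ^ j * 2 ^ j)) * d ^ 2) := by
          rw [ENNReal.ofReal_mul (by positivity), ENNReal.ofReal_mul (by positivity),
            ENNReal.ofReal_mul (p := 16) (by positivity), ENNReal.ofReal_mul h2.le,
            ENNReal.ofReal_ofNat]
          ring
      _ ≤ ENNReal.ofReal (B * t ^ 4 * ((3 / 4 : ℝ) ^ (j - n).natAbs) ^ 2 * d ^ 2) := by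
          exact ENNReal.ofReal_le_ofReal (mul_le_mul_of_nonneg_right (hn j) (sq_nonneg d))
      _ = _ := by
          rw [← ENNReal.ofReal_pow (by positivity)]
          congr 1
          rw [mul_pow, mul_pow, Real.sq_sqrt hB0]; ring
  calc _ ≤ ∑' j, ∫⁻ p in crossSet h j, ENNReal.ofReal (h p) := lintegral_iUnion_le _ _
    _ ≤ ∑' j, ENNReal.ofReal (√B * (t ^ 2 * d)) * ENNReal.ofReal ((3 / 4) ^ (j - n).natAbs) :=
        ENNReal.tsum_le_tsum hj
    _ = _ := by
      rw [ENNReal.tsum_mul_left, tsum_pow_natAbs_sub, ← ENNReal.ofReal_mul (by positivity)]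
      congr 1; ring

theorem lintegral_comp_swap (F : Plane → ℝ≥0∞) : ∫⁻ p, F (Prod.swap p) = ∫⁻ p, F p :=
  (Measure.measurePreserving_swap (μ := (volume : Measure ℝ))
    (ν := (volume : Measure ℝ))).lintegral_comp_emb
    MeasurableEquiv.prodComm.measurableEmbedding F

theorem setLIntegral_comp_swap (F : Plane → ℝ≥0∞) (s : Set Plane) :
    ∫⁻ p in Prod.swap ⁻¹' s, F (Prod.swap p) = ∫⁻ p in s, F p :=
  (Measure.measurePreserving_swap (μ := (volume : Measure ℝ))
    (ν := (volume : Measure ℝ))).setLIntegral_comp_preimage_emb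
    MeasurableEquiv.prodComm.measurableEmbedding F s

theorem lintegral_le (hc : 0 < c)
    (H₁ : SliceBounds (ENNReal.ofReal c) h κ δ₁)
    (H₂ : SliceBounds (ENNReal.ofReal c) (h ∘ Prod.swap) (κ ∘ Prod.swap) δ₂)
    {t : ℝ} (ht : 0 ≤ t) (hk : ∫⁻ p, κ p = ENNReal.ofReal (t ^ 3))
    {d : ℝ} (hd : 0 ≤ d) (hD₁ : ∫⁻ p, δ₁ p ^ 2 ≤ ENNReal.ofReal (d ^ 2))
    (hD₂ : ∫⁻ p, δ₂ p ^ 2 ≤ ENNReal.ofReal (d ^ 2)) :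
    ∫⁻ p, ENNReal.ofReal (h p) ≤ ENNReal.ofReal (2 * (8 / c * t ^ 3 +
      √(16 * (1 / c + 4 / c ^ 2)) * (∑' j : ℤ, (3 / 4 : ℝ) ^ j.natAbs) * (t ^ 2 * d))) := by
  have hk' : ∫⁻ p, (κ ∘ Prod.swap) p = ENNReal.ofReal (t ^ 3) := by
    rw [← hk]; exact lintegral_comp_swap κ
  have hc0 : ENNReal.ofReal c ≠ 0 := (ENNReal.ofReal_pos.2 hc).ne'
  have low {h' : Plane → ℝ} {κ' δ' : Plane → ℝ≥0∞}
      (H : SliceBounds (ENNReal.ofReal c) h' κ' δ') (hκ : ∫⁻ p, κ' p = ENNReal.ofReal (t ^ 3)) :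
      ∫⁻ p in ⋃ j, lowSet h' j, ENNReal.ofReal (h' p) ≤ ENNReal.ofReal (8 / c * t ^ 3) := by
    have := H.lintegral_iUnion_lowSet_le ENNReal.ofReal_ne_top
    rw [hκ, mul_comm, ← ENNReal.le_div_iff_mul_le (Or.inl hc0) (Or.inl ENNReal.ofReal_ne_top),
      ← ENNReal.ofReal_ofNat 8, ← ENNReal.ofReal_mul (by norm_num),
      ← ENNReal.ofReal_div_of_pos hc] at this
    exact this.trans_eq (by congr 1; ring)
  have low₁ := low H₁ hk
  have low₂ := low H₂ hk'
  have cross₁ := lintegral_iUnion_crossSet_le hc H₁ H₂ ht hk hk' hd hD₁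
  have cross₂ := lintegral_iUnion_crossSet_le hc H₂ (δ₂ := δ₁) H₁ ht hk' hk hd hD₂
  set L₂ : Set Plane := Prod.swap ⁻¹' ⋃ j, lowSet (h ∘ Prod.swap) j
  set T₂ : Set Plane := Prod.swap ⁻¹' ⋃ j, crossSet (h ∘ Prod.swap) j
  have low₂' : ∫⁻ p in L₂, ENNReal.ofReal (h p) ≤ ENNReal.ofReal (8 / c * t ^ 3) := by
    rw [← setLIntegral_comp_swap] at low₂
    simpa only [Function.comp_apply, Prod.swap_swap] using low₂
  have cross₂' : ∫⁻ p in T₂, ENNReal.ofReal (h p) ≤ ENNReal.ofReal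
      (√(16 * (1 / c + 4 / c ^ 2)) * (∑' j : ℤ, (3 / 4 : ℝ) ^ j.natAbs) * (t ^ 2 * d)) := by
    rw [← setLIntegral_comp_swap] at cross₂
    simpa only [Function.comp_apply, Prod.swap_swap] using cross₂
  set U : Set Plane := ((⋃ j, lowSet h j) ∪ L₂) ∪ ((⋃ j, crossSet h j) ∪ T₂) with hU
  have hcover : ∀ᵐ p : Plane, ENNReal.ofReal (h p) ≤
      U.indicator (fun p => ENNReal.ofReal (h p)) p := by
    have h₂ := (Measure.measurePreserving_swap (μ := (volume : Measure ℝ))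
      (ν := (volume : Measure ℝ))).quasiMeasurePreserving.ae
      (H₂.ae_exists_mem_maxGoodSet hc0 (by rw [hk']; exact ENNReal.ofReal_ne_top))
    filter_upwards [H₁.ae_exists_mem_maxGoodSet hc0 (by rw [hk]; exact ENNReal.ofReal_ne_top), h₂]
      with p hp₁ hp₂
    by_cases hpos : 0 < h p
    swap
    · rw [ENNReal.ofReal_of_nonpos (not_lt.1 hpos)]; exact zero_le
    obtain ⟨i, hi⟩ := hp₁ hpos
    obtain ⟨j, hj⟩ := hp₂ (by simpa using hpos)
    -- Here `i` and `j` are the maximal scales in directions `x` and `y`. If the point is low in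
    -- neither direction, it is tall at the smaller scale, and good there in the other direction
    -- too, because good sets decrease with the scale.
    have hpU : p ∈ U := by
      by_cases hl₁ : h p ≤ 8 * 2 ^ i
      · exact Or.inl (Or.inl (Set.mem_iUnion.2 ⟨i, hi, hl₁⟩))
      by_cases hl₂ : h p ≤ 8 * 2 ^ j
      · exact Or.inl (Or.inr (Set.mem_iUnion.2 ⟨j, hj, hl₂⟩))
      rcases le_total i j with hij | hij
      · refine Or.inr (Or.inl (Set.mem_iUnion.2 ⟨i, ⟨hi, not_le.1 hl₁⟩, ?_⟩))
        exact good_antitone _ hij hj.1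
      · refine Or.inr (Or.inr (Set.mem_iUnion.2 ⟨j, ⟨hj, not_le.1 hl₂⟩, ?_⟩))
        exact good_antitone _ hij hi.1
    rw [Set.indicator_of_mem hpU]
  calc _ ≤ ∫⁻ p, U.indicator (fun p => ENNReal.ofReal (h p)) p := lintegral_mono_ae hcover
    _ ≤ ∫⁻ p in U, ENNReal.ofReal (h p) := lintegral_indicator_le _ _
    _ ≤ ((∫⁻ p in ⋃ j, lowSet h j, ENNReal.ofReal (h p)) + ∫⁻ p in L₂, ENNReal.ofReal (h p)) +
        ((∫⁻ p in ⋃ j, crossSet h j, ENNReal.ofReal (h p)) +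
          ∫⁻ p in T₂, ENNReal.ofReal (h p)) :=
      (lintegral_union_le _ _ _).trans
        (add_le_add (lintegral_union_le _ _ _) (lintegral_union_le _ _ _))
    _ ≤ _ := add_le_add (add_le_add low₁ low₂') (add_le_add cross₁ cross₂')
    _ = _ := by
      have hS : 0 ≤ ∑' j : ℤ, (3 / 4 : ℝ) ^ j.natAbs := tsum_nonneg fun _ => by positivity
      rw [← ENNReal.ofReal_add (by positivity) (by positivity),
        ← ENNReal.ofReal_add (by positivity) (by positivity),
        ← ENNReal.ofReal_add (by positivity) (by positivity)]
      congr 1; ring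

end SliceBounds

/-! ### Weak derivatives on lines and the oscillation of the profile. -/

theorem fderiv_apply_fst {φ : Plane → ℝ} (hφ : Differentiable ℝ φ) (x y : ℝ) :
    fderiv ℝ φ (x, y) (1, 0) = deriv (fun t => φ (t, y)) x := by
  have h := (hφ (x, y)).hasFDerivAt.comp_hasDerivAt x
    ((hasDerivAt_id x).prodMk (hasDerivAt_const x y))
  exact h.deriv.symm

theorem hasCompactSupport_mul_prod {X Y : Type*} [TopologicalSpace X] [TopologicalSpace Y]
    [R1Space X] [R1Space Y] {α : X → ℝ} {β : Y → ℝ} (hα : HasCompactSupport α)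
    (hβ : HasCompactSupport β) : HasCompactSupport fun p : X × Y => α p.1 * β p.2 := by
  refine HasCompactSupport.of_support_subset_isCompact (IsCompact.prod hα hβ) fun p hp => ?_
  rw [Function.mem_support] at hp
  exact ⟨subset_tsupport _ (left_ne_zero_of_mul hp), subset_tsupport _ (right_ne_zero_of_mul hp)⟩

theorem contDiff_mul_prod {α β : ℝ → ℝ} (hα : ContDiff ℝ ∞ α) (hβ : ContDiff ℝ ∞ β) :
    ContDiff ℝ ∞ fun p : Plane => α p.1 * β p.2 :=
  ContDiff.mul (hα.comp contDiff_fst) (hβ.comp contDiff_snd)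

theorem fderiv_mul_prod_apply_fst {α β : ℝ → ℝ} (hα : ContDiff ℝ ∞ α)
    (hβ : ContDiff ℝ ∞ β) (p : Plane) :
    fderiv ℝ (fun p : Plane => α p.1 * β p.2) p (1, 0) = deriv α p.1 * β p.2 := by
  obtain ⟨x, y⟩ := p
  rw [fderiv_apply_fst ((contDiff_mul_prod hα hβ).differentiable (by simp)) x y]
  exact ((hα.differentiable (by simp) x).hasDerivAt.mul_const (β y)).deriv

/-- On almost every line in direction `x`, the restriction of a weak derivative in direction `x`
acts as a weak derivative against a given test function. -/
theorem ae_slice_integral_eq {h d : Plane → ℝ} (hh : MemLp h ⊤) (hd : MemLp d ⊤)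
    (hw : ∀ φ : Plane → ℝ, ContDiff ℝ ∞ φ → HasCompactSupport φ →
      ∫ p, h p * fderiv ℝ φ p (1, 0) = -∫ p, d p * φ p)
    {α : ℝ → ℝ} (hα : ContDiff ℝ ∞ α) (hαc : HasCompactSupport α) :
    ∀ᵐ y, ∫ x, h (x, y) * deriv α x = -∫ x, d (x, y) * α x := by
  have hα' : Continuous (deriv α) := hα.continuous_deriv (by simp)
  have iα : Integrable α := hα.continuous.integrable_of_hasCompactSupport hαc
  have iα' : Integrable (deriv α) := hα'.integrable_of_hasCompactSupport hαc.deriv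
  have I {f : Plane → ℝ} (hf : MemLp f ⊤) {a b : ℝ → ℝ} (ha : Integrable a) (hb : Integrable b) :
      Integrable fun p : ℝ × ℝ => f p * (a p.1 * b p.2) := by
    refine ((ha.mul_prod hb).mul_of_top_left hf).congr (Eventually.of_forall fun p => ?_)
    exact mul_comm _ _
  -- The functions are only bounded, so a Gaussian weight in `y` makes the integrand integrable on
  -- the plane. It is absorbed into the test function as `η = γ ρ` and cancelled at the end by
  -- positivity.
  set ρ : ℝ → ℝ := fun y => Real.exp (-1 * y ^ 2) with hρ
  have hρs : ContDiff ℝ ∞ ρ := by fun_prop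
  have iρ : Integrable ρ := integrable_exp_neg_mul_sq one_pos
  have J₁ := I hh iα' iρ
  have J₂ := I hd iα iρ
  set F : ℝ × ℝ → ℝ := fun p => h p * (deriv α p.1 * ρ p.2) + d p * (α p.1 * ρ p.2) with hF
  have J : Integrable F := J₁.add J₂
  have hz : ∀ᵐ y : ℝ, ∫ x, F (x, y) = 0 := by
    refine ae_eq_zero_of_integral_contDiff_smul_eq_zero
      (Integrable.integral_prod_right J).locallyIntegrable fun γ hγ hγc => ?_
    obtain ⟨η, hη⟩ : ∃ η : ℝ → ℝ, η = fun y => γ y * ρ y := ⟨_, rfl⟩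
    have hηs : ContDiff ℝ ∞ η := hη ▸ hγ.mul hρs
    have hηc : HasCompactSupport η := hη ▸ hγc.mul_right
    have iη : Integrable η := hηs.continuous.integrable_of_hasCompactSupport hηc
    have K₁ := I hh iα' iη
    have K₂ := I hd iα iη
    have hw' := hw _ (contDiff_mul_prod hα hηs) (hasCompactSupport_mul_prod hαc hηc)
    simp_rw [fderiv_mul_prod_apply_fst hα hηs] at hw'
    have hF' (p : ℝ × ℝ) : γ p.2 * F p = h p * (deriv α p.1 * η p.2) + d p * (α p.1 * η p.2) := by
      simp only [hF, hη]; ring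
    calc ∫ y, γ y • ∫ x, F (x, y) = ∫ y, ∫ x, γ y * F (x, y) := by
          simp_rw [smul_eq_mul, integral_const_mul]
      _ = ∫ p : ℝ × ℝ, γ p.2 * F p := by
          rw [Measure.volume_eq_prod, integral_prod_symm (fun p : ℝ × ℝ => γ p.2 * F p)]
          simp_rw [hF']
          exact K₁.add K₂
      _ = (∫ p : ℝ × ℝ, h p * (deriv α p.1 * η p.2)) + ∫ p : ℝ × ℝ, d p * (α p.1 * η p.2) := by
          simp_rw [hF']
          exact integral_add K₁ K₂
      _ = 0 := by rw [hw', neg_add_cancel]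
  filter_upwards [hz, Integrable.prod_left_ae J₁, Integrable.prod_left_ae J₂] with y hy h₁ h₂
  have hy' : (∫ x, h (x, y) * (deriv α x * ρ y)) + ∫ x, d (x, y) * (α x * ρ y) = 0 := by
    rw [← integral_add h₁ h₂]; exact hy
  simp_rw [← mul_assoc, integral_mul_const] at hy'
  rw [← add_mul, mul_eq_zero] at hy'
  exact eq_neg_of_add_eq_zero_left (hy'.resolve_right (Real.exp_pos _).ne')

theorem deriv_smoothTransition_of_nonpos {t : ℝ} (ht : t ≤ 0) :
    deriv Real.smoothTransition t = 0 := by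
  refine IsLocalMin.deriv_eq_zero (Eventually.of_forall fun s => ?_)
  rw [Real.smoothTransition.zero_of_nonpos ht]
  exact Real.smoothTransition.nonneg s

theorem deriv_smoothTransition_of_one_le {t : ℝ} (ht : 1 ≤ t) :
    deriv Real.smoothTransition t = 0 := by
  refine IsLocalMax.deriv_eq_zero (Eventually.of_forall fun s => ?_)
  rw [Real.smoothTransition.one_of_one_le ht]
  exact Real.smoothTransition.le_one s

theorem continuous_deriv_smoothTransition : Continuous (deriv Real.smoothTransition) :=
  (Real.smoothTransition.contDiff (n := 1)).continuous_deriv le_rfl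

theorem exists_bound_deriv_smoothTransition : ∃ M, ∀ x, ‖deriv Real.smoothTransition x‖ ≤ M :=
  continuous_deriv_smoothTransition.bounded_above_of_compact_support
    (HasCompactSupport.of_support_subset_isCompact (isCompact_Icc (a := (0 : ℝ)) (b := 1))
      fun x hx => by
        constructor
        · by_contra! h0; exact hx (deriv_smoothTransition_of_nonpos h0.le)
        · by_contra! h0; exact hx (deriv_smoothTransition_of_one_le h0.le))

/-- The kernels have mass one and concentrate at `a`. The shift `s` selects the side: their support
lies to the right of `a` for `s = 0` and to the left for `s = 1`. -/
theorem tendsto_integral_mul_deriv_smoothTransition {f : ℝ → ℝ} (hf : Continuous f) (a s : ℝ) :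
    Tendsto (fun n : ℕ => ∫ x, f x * ((n + 1) *
      deriv Real.smoothTransition ((n + 1) * (x - a) + s))) atTop (𝓝 (f a)) := by
  set G : ℝ → ℝ := fun ε => ∫ t in (0 : ℝ)..1, f (a + (t - s) * ε) * deriv Real.smoothTransition t
    with hG
  have hGc : Continuous G := by
    refine intervalIntegral.continuous_parametric_intervalIntegral_of_continuous' ?_ 0 1
    have := continuous_deriv_smoothTransition
    unfold Function.uncurry
    fun_prop
  have hG0 : G 0 = f a := by
    simp only [hG, mul_zero, add_zero, intervalIntegral.integral_const_mul]
    rw [intervalIntegral.integral_deriv_eq_sub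
      (fun x _ => (Real.smoothTransition.contDiff (n := 1)).differentiable one_ne_zero x)
      (continuous_deriv_smoothTransition.intervalIntegrable _ _)]
    simp
  have hlim : Tendsto (fun n : ℕ => G (1 / ((n : ℝ) + 1))) atTop (𝓝 (f a)) := by
    rw [← hG0]
    exact (hGc.tendsto 0).comp tendsto_one_div_add_atTop_nhds_zero_nat
  refine hlim.congr fun n => ?_
  have hn : (0 : ℝ) < n + 1 := by positivity
  simp only [hG]
  rw [intervalIntegral.integral_eq_integral_of_support_subset]
  · set Φ : ℝ → ℝ := fun t => f (a + (t - s) * (1 / (n + 1))) * deriv Real.smoothTransition t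
      with hΦ
    calc ∫ t, Φ t = (n + 1) * ∫ x, Φ ((n + 1) * x + s) := by
          rw [Measure.integral_comp_mul_left (fun t => Φ (t + s)), integral_add_right_eq_self,
            smul_eq_mul, abs_of_pos (inv_pos.2 hn), mul_inv_cancel_left₀ hn.ne']
      _ = (n + 1) * ∫ x, Φ ((n + 1) * (x - a) + s) := by
          rw [integral_sub_right_eq_self fun x => Φ ((n + 1) * x + s)]
      _ = _ := by
          rw [← integral_const_mul]
          congr 1; ext x
          simp only [hΦ]
          rw [show a + ((n + 1) * (x - a) + s - s) * (1 / ((n : ℝ) + 1)) = x by field_simp; ring]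
          ring
  · intro t ht
    rw [Function.mem_support] at ht
    have h' := right_ne_zero_of_mul ht
    constructor
    · by_contra! h0; exact h' (deriv_smoothTransition_of_nonpos h0)
    · by_contra! h0; exact h' (deriv_smoothTransition_of_one_le h0.le)

/-- A smooth approximation, supported in `[a, b]`, of the indicator of `[a, b]`. -/
noncomputable def ramp (a b : ℝ) (n : ℕ) (x : ℝ) : ℝ :=
  Real.smoothTransition ((n + 1) * (x - a)) - Real.smoothTransition ((n + 1) * (x - b) + 1)

theorem contDiff_ramp (a b : ℝ) (n : ℕ) : ContDiff ℝ ∞ (ramp a b n) :=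
  (Real.smoothTransition.contDiff.comp (by fun_prop)).sub
    (Real.smoothTransition.contDiff.comp (by fun_prop))

theorem abs_ramp_le (a b : ℝ) (n : ℕ) (x : ℝ) : |ramp a b n x| ≤ 1 := by
  have h1 := Real.smoothTransition.nonneg ((n + 1) * (x - a))
  have h2 := Real.smoothTransition.le_one ((n + 1) * (x - a))
  have h3 := Real.smoothTransition.nonneg ((n + 1) * (x - b) + 1)
  have h4 := Real.smoothTransition.le_one ((n + 1) * (x - b) + 1)
  rw [ramp, abs_le]; constructor <;> linarith

theorem ramp_eq_zero {a b : ℝ} {n : ℕ} (hn : 1 ≤ (n + 1) * (b - a)) {x : ℝ}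
    (hx : x ∉ Set.Icc a b) : ramp a b n x = 0 := by
  have hn0 : (0 : ℝ) < n + 1 := by positivity
  rw [Set.mem_Icc, not_and_or, not_le, not_le] at hx
  rcases hx with hx | hx
  · rw [ramp, Real.smoothTransition.zero_of_nonpos, Real.smoothTransition.zero_of_nonpos, sub_zero]
    · nlinarith
    · nlinarith
  · rw [ramp, Real.smoothTransition.one_of_one_le, Real.smoothTransition.one_of_one_le, sub_self]
    · nlinarith
    · nlinarith

theorem hasCompactSupport_ramp {a b : ℝ} {n : ℕ} (hn : 1 ≤ (n + 1) * (b - a)) :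
    HasCompactSupport (ramp a b n) :=
  HasCompactSupport.of_support_subset_isCompact (isCompact_Icc (a := a) (b := b)) fun x hx => by
    by_contra h; exact hx (ramp_eq_zero hn h)

theorem deriv_ramp (a b : ℝ) (n : ℕ) (x : ℝ) : deriv (ramp a b n) x =
    (n + 1) * deriv Real.smoothTransition ((n + 1) * (x - a) + 0) -
      (n + 1) * deriv Real.smoothTransition ((n + 1) * (x - b) + 1) := by
  have hS (t : ℝ) : HasDerivAt Real.smoothTransition (deriv Real.smoothTransition t) t :=
    ((Real.smoothTransition.contDiff (n := 1)).differentiable one_ne_zero t).hasDerivAt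
  have h1 : HasDerivAt (fun x => ((n : ℝ) + 1) * (x - a)) (n + 1) x := by
    simpa using ((hasDerivAt_id x).sub_const a).const_mul ((n : ℝ) + 1)
  have h2 : HasDerivAt (fun x => ((n : ℝ) + 1) * (x - b) + 1) (n + 1) x := by
    simpa using (((hasDerivAt_id x).sub_const b).const_mul ((n : ℝ) + 1)).add_const 1
  have := ((hS _).comp x h1).sub ((hS _).comp x h2)
  rw [add_zero, mul_comm (n + 1 : ℝ), mul_comm (n + 1 : ℝ) (deriv _ ((n + 1) * (x - b) + 1))]
  exact this.deriv

/-- The derivative of the ramp tends to `δ_a - δ_b`, so the left side of `hr` tends to `f a - f b`;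
the right side is controlled because the ramps are bounded by one and vanish off `[a, b]`. -/
theorem ofReal_abs_sub_le_of_ramp {f d : ℝ → ℝ} (hf : Continuous f) {a b : ℝ} (hab : a < b)
    (hr : ∀ n : ℕ, 1 ≤ (n + 1) * (b - a) →
      ∫ x, f x * deriv (ramp a b n) x = -∫ x, d x * ramp a b n x) :
    ENNReal.ofReal |f b - f a| ≤ ∫⁻ x in Set.Icc a b, ‖d x‖ₑ := by
  have hS (n : ℕ) (c s : ℝ) : HasCompactSupport fun x =>
      ((n : ℝ) + 1) * deriv Real.smoothTransition ((n + 1) * (x - c) + s) := by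
    have hn0 : (0 : ℝ) < n + 1 := by positivity
    refine HasCompactSupport.of_support_subset_isCompact
      (isCompact_Icc (a := c + (0 - s) / (n + 1)) (b := c + (1 - s) / (n + 1))) fun x hx => ?_
    rw [Function.mem_support] at hx
    have hx' := right_ne_zero_of_mul hx
    constructor
    · by_contra! h0
      refine hx' (deriv_smoothTransition_of_nonpos ?_)
      rw [← sub_lt_iff_lt_add', lt_div_iff₀ hn0] at h0; linarith
    · by_contra! h0
      refine hx' (deriv_smoothTransition_of_one_le ?_)
      rw [← lt_sub_iff_add_lt', div_lt_iff₀ hn0] at h0; linarith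
  have hI (n : ℕ) (c s : ℝ) : Integrable fun x =>
      f x * (((n : ℝ) + 1) * deriv Real.smoothTransition ((n + 1) * (x - c) + s)) := by
    refine Continuous.integrable_of_hasCompactSupport ?_ (hS n c s).mul_left
    have := continuous_deriv_smoothTransition
    fun_prop
  have hlim : Tendsto (fun n : ℕ => ENNReal.ofReal |∫ x, f x * deriv (ramp a b n) x|) atTop
      (𝓝 (ENNReal.ofReal |f a - f b|)) := by
    refine ENNReal.tendsto_ofReal (Tendsto.abs ?_)
    refine ((tendsto_integral_mul_deriv_smoothTransition hf a 0).sub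
      (tendsto_integral_mul_deriv_smoothTransition hf b 1)).congr fun n => ?_
    rw [← integral_sub (hI n a 0) (hI n b 1)]
    congr 1; ext x
    rw [deriv_ramp]; ring
  rw [abs_sub_comm]
  refine le_of_tendsto hlim ?_
  obtain ⟨N, hN⟩ := exists_nat_gt (1 / (b - a))
  filter_upwards [eventually_ge_atTop N] with n hn
  have hba : 0 < b - a := sub_pos.2 hab
  have hn1 : 1 ≤ (n + 1) * (b - a) := by
    rw [div_lt_iff₀ hba] at hN
    have : (N : ℝ) ≤ n := by exact_mod_cast hn
    nlinarith
  rw [hr n hn1, abs_neg, ← Real.norm_eq_abs, ofReal_norm, ← lintegral_indicator measurableSet_Icc]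
  refine (enorm_integral_le_lintegral_enorm _).trans (lintegral_mono fun x => ?_)
  by_cases hx : x ∈ Set.Icc a b
  · rw [Set.indicator_of_mem hx, enorm_mul]
    refine mul_le_of_le_one_right' ?_
    rw [← ofReal_norm, Real.norm_eq_abs]
    exact ENNReal.ofReal_le_one.2 (abs_ramp_le a b n x)
  · rw [ramp_eq_zero hn1 hx]; simp

/-- Rational endpoints approach `a` and `b` from inside the interval, so the integral never exceeds
the one over `[a, b]`. -/
theorem ofReal_abs_sub_le_of_rat {f : ℝ → ℝ} (hf : Continuous f) {δ : ℝ → ℝ≥0∞}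
    (hq : ∀ a b : ℚ, a < b →
      ENNReal.ofReal |f b - f a| ≤ ∫⁻ x in Set.Icc (a : ℝ) b, δ x)
    {a b : ℝ} (hab : a < b) :
    ENNReal.ofReal |f b - f a| ≤ ∫⁻ x in Set.Icc a b, δ x := by
  obtain ⟨u, -, hu, hu'⟩ := Real.exists_seq_rat_strictAnti_tendsto a
  obtain ⟨v, -, hv, hv'⟩ := Real.exists_seq_rat_strictMono_tendsto b
  have hlim : Tendsto (fun n => ENNReal.ofReal |f (v n) - f (u n)|) atTop
      (𝓝 (ENNReal.ofReal |f b - f a|)) :=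
    ENNReal.tendsto_ofReal
      (((hf.tendsto b).comp hv').sub ((hf.tendsto a).comp hu')).abs
  refine le_of_tendsto hlim ?_
  have hlt : ∀ᶠ n in atTop, (u n : ℝ) < v n := hu'.eventually_lt hv' hab
  filter_upwards [hlt] with n hn
  exact (hq _ _ (by exact_mod_cast hn)).trans
    (lintegral_mono_set (Set.Icc_subset_Icc (hu n).le (hv n).le))

theorem ae_cellOscBound {h : Plane → ℝ} {Dh : Plane → Fin 2 → ℝ} (hc : Continuous h)
    (hs : IsSobolev dir2 Set.univ ⊤ h Dh) :
    ∀ᵐ y : ℝ, CellOscBound (fun x => h (x, y)) fun x => ‖Dh (x, y) 0‖ₑ := by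
  have hh : MemLp h ⊤ := by simpa using hs.memLp
  have hd : MemLp (fun p => Dh p 0) ⊤ := by simpa using hs.memLp_grad 0
  have hw (φ : Plane → ℝ) (h1 : ContDiff ℝ ∞ φ) (h2 : HasCompactSupport φ) :
      ∫ p, h p * fderiv ℝ φ p (1, 0) = -∫ p, Dh p 0 * φ p := by
    simpa [dir2] using hs.weak_grad 0 φ h1 h2 (Set.subset_univ _)
  -- The exceptional null set depends on the test function; a countable family of ramps leaves one
  -- null set for all of them.
  have hall : ∀ᵐ y : ℝ, ∀ (a b : ℚ) (n : ℕ), 1 ≤ (n + 1) * ((b : ℝ) - a) →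
      ∫ x, h (x, y) * deriv (ramp a b n) x = -∫ x, Dh (x, y) 0 * ramp a b n x := by
    simp_rw [ae_all_iff]
    intro a b n hn
    exact ae_slice_integral_eq hh hd hw (contDiff_ramp a b n) (hasCompactSupport_ramp hn)
  filter_upwards [hall] with y hy
  have hcy : Continuous fun x => h (x, y) := hc.comp (by fun_prop)
  have key {a b : ℝ} (hab : a < b) :
      ENNReal.ofReal |h (b, y) - h (a, y)| ≤ ∫⁻ x in Set.Icc a b, ‖Dh (x, y) 0‖ₑ :=
    ofReal_abs_sub_le_of_rat hcy (fun a b hab => ofReal_abs_sub_le_of_ramp hcy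
      (by exact_mod_cast hab) (hy a b)) hab
  intro j k s hs t ht
  rcases lt_trichotomy s t with hst | rfl | hst
  · refine (ENNReal.ofReal_le_ofReal ?_).trans
      ((key hst).trans (lintegral_mono_set (Set.Icc_subset_Icc hs.1 ht.2)))
    rw [abs_sub_comm]; exact le_abs_self _
  · simp
  · exact (ENNReal.ofReal_le_ofReal (le_abs_self _)).trans
      ((key hst).trans (lintegral_mono_set (Set.Icc_subset_Icc ht.1 hs.2)))

/-! ### The elastic energy over a good dyadic interval. -/

/-- The function `(x, y, z) ↦ α x * β y * γ z`. -/
def tensor (α β γ : ℝ → ℝ) (q : Space) : ℝ := α q.1.1 * β q.1.2 * γ q.2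

section tensor

variable {α β γ : ℝ → ℝ}

theorem contDiff_tensor (hα : ContDiff ℝ ∞ α) (hβ : ContDiff ℝ ∞ β) (hγ : ContDiff ℝ ∞ γ) :
    ContDiff ℝ ∞ (tensor α β γ) :=
  ContDiff.mul (ContDiff.mul (hα.comp (contDiff_fst.comp contDiff_fst))
    (hβ.comp (contDiff_snd.comp contDiff_fst))) (hγ.comp contDiff_snd)

theorem tsupport_tensor_subset :
    tsupport (tensor α β γ) ⊆ (tsupport α ×ˢ tsupport β) ×ˢ tsupport γ := by
  refine closure_minimal (fun q hq => ?_) (((isClosed_tsupport _).prod (isClosed_tsupport _)).prod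
    (isClosed_tsupport _))
  rw [Function.mem_support, tensor] at hq
  exact ⟨⟨subset_tsupport _ (left_ne_zero_of_mul (left_ne_zero_of_mul hq)),
    subset_tsupport _ (right_ne_zero_of_mul (left_ne_zero_of_mul hq))⟩,
    subset_tsupport _ (right_ne_zero_of_mul hq)⟩

theorem hasCompactSupport_tensor (hα : HasCompactSupport α) (hβ : HasCompactSupport β)
    (hγ : HasCompactSupport γ) : HasCompactSupport (tensor α β γ) :=
  ((IsCompact.prod hα hβ).prod hγ).of_isClosed_subset (isClosed_tsupport _) tsupport_tensor_subset

theorem fderiv_apply_dir3_zero {φ : Space → ℝ} (hφ : Differentiable ℝ φ) (x y z : ℝ) :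
    fderiv ℝ φ ((x, y), z) (dir3 0) = deriv (fun t => φ ((t, y), z)) x := by
  have h := (hφ ((x, y), z)).hasFDerivAt.comp_hasDerivAt x
    (((hasDerivAt_id x).prodMk (hasDerivAt_const x y)).prodMk (hasDerivAt_const x z))
  exact h.deriv.symm

theorem fderiv_apply_dir3_two {φ : Space → ℝ} (hφ : Differentiable ℝ φ) (s : Plane) (z : ℝ) :
    fderiv ℝ φ (s, z) (dir3 2) = deriv (fun t => φ (s, t)) z := by
  have h := (hφ (s, z)).hasFDerivAt.comp_hasDerivAt z
    ((hasDerivAt_const z s).prodMk (hasDerivAt_id z))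
  exact h.deriv.symm

theorem fderiv_tensor_zero (hα : ContDiff ℝ ∞ α) (hβ : ContDiff ℝ ∞ β) (hγ : ContDiff ℝ ∞ γ)
    (q : Space) : fderiv ℝ (tensor α β γ) q (dir3 0) = tensor (deriv α) β γ q := by
  obtain ⟨⟨x, y⟩, z⟩ := q
  rw [fderiv_apply_dir3_zero ((contDiff_tensor hα hβ hγ).differentiable (by simp))]
  exact (((hα.differentiable (by simp) x).hasDerivAt.mul_const (β y)).mul_const (γ z)).deriv

theorem fderiv_tensor_two (hα : ContDiff ℝ ∞ α) (hβ : ContDiff ℝ ∞ β) (hγ : ContDiff ℝ ∞ γ)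
    (q : Space) : fderiv ℝ (tensor α β γ) q (dir3 2) = tensor α β (deriv γ) q := by
  obtain ⟨⟨x, y⟩, z⟩ := q
  rw [fderiv_apply_dir3_two ((contDiff_tensor hα hβ hγ).differentiable (by simp))]
  exact ((hγ.differentiable (by simp) z).hasDerivAt.const_mul (α x * β y)).deriv

end tensor

theorem measurableSet_film {h : Plane → ℝ} (hh : Continuous h) : MeasurableSet (film h) :=
  (measurableSet_lt measurable_const measurable_snd).inter
    (measurableSet_lt measurable_snd (hh.measurable.comp measurable_fst))

theorem volume_film {h : Plane → ℝ} (hh : Continuous h) :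
    volume (film h) = ∫⁻ s, ENNReal.ofReal (h s) := by
  have hf : film h = regionBetween (fun _ => 0) h Set.univ := by
    ext q; simp [film, regionBetween]
  rw [hf, Measure.volume_eq_prod, volume_regionBetween_eq_lintegral aemeasurable_const
    hh.aemeasurable MeasurableSet.univ]
  simp

/-- The test functions `a`, `bp`, `b` on the square of side length `2 ^ j`: `a` lives over the
dyadic interval, `bp` cuts off below the height `2 ^ j` and `b` is a compactly supported function
that agrees with `bp` on positive heights. -/
structure Cutoff (j k : ℤ) (a bp b : ℝ → ℝ) : Prop where
  contDiff_a : ContDiff ℝ ∞ a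
  contDiff_bp : ContDiff ℝ ∞ bp
  contDiff_b : ContDiff ℝ ∞ b
  compact_b : HasCompactSupport b
  tsupport_a : tsupport a ⊆ cell j k
  tsupport_b : ∀ z ∈ tsupport b, z < 2 ^ j
  tsupport_deriv_bp : tsupport (deriv bp) ⊆ Set.Ioo 0 (2 ^ j)
  bp_eq_zero : ∀ z, 2 ^ j ≤ z → bp z = 0
  b_eq : ∀ z, 0 < z → b z = bp z
  b_zero : b 0 = 1

namespace Cutoff

variable {j k : ℤ} {a bp b : ℝ → ℝ}

theorem compact_a (C : Cutoff j k a bp b) : HasCompactSupport a :=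
  (isCompact_Icc : IsCompact (dyadic j k)).of_isClosed_subset (isClosed_tsupport _)
    (C.tsupport_a.trans (cell_subset_dyadic j k))

theorem compact_deriv_bp (C : Cutoff j k a bp b) : HasCompactSupport (deriv bp) :=
  (isCompact_Icc : IsCompact (Set.Icc (0 : ℝ) (2 ^ j))).of_isClosed_subset (isClosed_tsupport _)
    (C.tsupport_deriv_bp.trans Set.Ioo_subset_Icc_self)

/-- The weak derivative in `x` is tested with `a β bp'`, the trace identity with `a' β b`. Both
produce the same term `∫ v a' β bp'` over the film, which cancels on subtraction. What remains is
the bottom term `∫ x a' β = -(∫ a)(∫ β)`. -/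
theorem green {h : Plane → ℝ} {v : Space → ℝ} {Dv : Space → Fin 3 → ℝ}
    (hh : Continuous h) (hv : IsSobolev dir3 (film h) 2 v Dv)
    (ht : HasBottomTrace h v (fun q => Dv q 2) fun s => s.1) (C : Cutoff j k a bp b)
    {β : ℝ → ℝ} (hβ : ContDiff ℝ ∞ β) (hβc : HasCompactSupport β)
    (hβs : tsupport β ⊆ goodOrdinates h j k) :
    (∫ q in film h, Dv q 0 * tensor a β (deriv bp) q) -
      ∫ q in film h, Dv q 2 * tensor (deriv a) β bp q = -((∫ x, a x) * ∫ y, β y) := by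
  have ha' : ContDiff ℝ ∞ (deriv a) := by
    simpa using C.contDiff_a.iterate_deriv 1
  have hbp' : ContDiff ℝ ∞ (deriv bp) := by
    simpa using C.contDiff_bp.iterate_deriv 1
  have h1 := hv.weak_grad 0 _ (contDiff_tensor C.contDiff_a hβ hbp')
    (hasCompactSupport_tensor C.compact_a hβc C.compact_deriv_bp)
    (fun q hq => by
      obtain ⟨⟨hx, hy⟩, hz⟩ := tsupport_tensor_subset hq
      have hz' := C.tsupport_deriv_bp hz
      exact ⟨hz'.1, hz'.2.trans (hβs hy _ (cell_subset_dyadic _ _ (C.tsupport_a hx)))⟩)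
  have h2 := ht _ (contDiff_tensor ha' hβ C.contDiff_b)
    (hasCompactSupport_tensor C.compact_a.deriv hβc C.compact_b)
    (fun q hq => by
      obtain ⟨⟨hx, hy⟩, hz⟩ := tsupport_tensor_subset hq
      have hx' := cell_subset_dyadic _ _ (C.tsupport_a (tsupport_deriv_subset hx))
      have hlt : (2 : ℝ) ^ j < h q.1 := hβs hy _ hx'
      exact ⟨lt_trans (by positivity) hlt, (C.tsupport_b _ hz).trans hlt⟩)
  simp_rw [fderiv_tensor_zero C.contDiff_a hβ hbp'] at h1
  simp_rw [fderiv_tensor_two ha' hβ C.contDiff_b] at h2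
  have hb' (z : ℝ) (hz : 0 < z) : deriv b z = deriv bp z :=
    Filter.EventuallyEq.deriv_eq ((eventually_gt_nhds hz).mono C.b_eq)
  have e1 : ∫ q in film h, v q * tensor (deriv a) β (deriv b) q =
      ∫ q in film h, v q * tensor (deriv a) β (deriv bp) q :=
    setIntegral_congr_fun (measurableSet_film hh) fun q hq => by
      simp only [tensor, hb' q.2 hq.1]
  have e2 : ∫ q in film h, Dv q 2 * tensor (deriv a) β b q =
      ∫ q in film h, Dv q 2 * tensor (deriv a) β bp q :=
    setIntegral_congr_fun (measurableSet_film hh) fun q hq => by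
      simp only [tensor, C.b_eq q.2 hq.1]
  have ia : Integrable a := C.contDiff_a.continuous.integrable_of_hasCompactSupport C.compact_a
  have e3 : ∫ x, x * deriv a x = -∫ x, a x := by
    have := integral_mul_deriv_eq_deriv_mul_of_integrable (u := fun x : ℝ => x) (v := a)
      (u' := fun _ => 1) (v' := deriv a) (fun x _ => hasDerivAt_id x)
      (fun x _ => (C.contDiff_a.differentiable (by simp) x).hasDerivAt)
      ((continuous_id.mul ha'.continuous).integrable_of_hasCompactSupport
        C.compact_a.deriv.mul_left)
      (ia.congr (Eventually.of_forall fun x => (one_mul _).symm))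
      ((continuous_id.mul C.contDiff_a.continuous).integrable_of_hasCompactSupport
        C.compact_a.mul_left)
    simpa using this
  have e4 : ∫ s : Plane, s.1 * tensor (deriv a) β b (s, 0) = -((∫ x, a x) * ∫ y, β y) := by
    have : (fun s : Plane => s.1 * tensor (deriv a) β b (s, 0)) =
        fun s : ℝ × ℝ => (s.1 * deriv a s.1) * β s.2 := by
      ext s; simp only [tensor, C.b_zero]; ring
    rw [this, Measure.volume_eq_prod, integral_prod_mul (fun x => x * deriv a x) β, e3]
    ring
  rw [e1, e2, e4] at h2
  linarith

/-- On almost every line that crosses the good ordinates, the elastic strain tested with the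
cutoff has a fixed value. -/
theorem ae_slice {h : Plane → ℝ} {v : Space → ℝ} {Dv : Space → Fin 3 → ℝ}
    (hh : Continuous h) (hi : Integrable h) (hv : IsSobolev dir3 (film h) 2 v Dv)
    (ht : HasBottomTrace h v (fun q => Dv q 2) fun s => s.1) (C : Cutoff j k a bp b)
    {M : ℝ} (hbM : ∀ z, 0 < z → |bp z| ≤ M) :
    ∀ᵐ y : ℝ, y ∈ goodOrdinates h j k → ∫ x, ∫ z, (film h).indicator (fun q =>
      Dv q 0 * (a q.1.1 * deriv bp q.2) - Dv q 2 * (deriv a q.1.1 * bp q.2)) ((x, y), z) =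
        -∫ x, a x := by
  have hm := measurableSet_film hh
  have hfin : volume (film h) ≠ ⊤ := by
    rw [volume_film hh]; exact hi.lintegral_lt_top.ne
  -- The finite volume of the film makes the square integrable gradient integrable, so Fubini
  -- applies.
  have : IsFiniteMeasure (volume.restrict (film h)) := ⟨by
    rw [Measure.restrict_apply_univ]; exact hfin.lt_top⟩
  have iD (i : Fin 3) : Integrable (fun q => Dv q i) (volume.restrict (film h)) :=
    (hv.memLp_grad i).integrable (by norm_num)
  have bdd {f : ℝ → ℝ} (hf : Continuous f) (hfc : HasCompactSupport f) :
      ∃ B, ∀ x, |f x| ≤ B := by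
    obtain ⟨B, hB⟩ := hf.bounded_above_of_compact_support hfc
    exact ⟨B, fun x => by simpa using hB x⟩
  have ca := C.contDiff_a.continuous
  have ca' : Continuous (deriv a) := C.contDiff_a.continuous_deriv (by simp)
  have cbp := C.contDiff_bp.continuous
  have cbp' : Continuous (deriv bp) := C.contDiff_bp.continuous_deriv (by simp)
  obtain ⟨A₀, hA₀⟩ := bdd ca C.compact_a
  obtain ⟨A₁, hA₁⟩ := bdd ca' C.compact_a.deriv
  obtain ⟨B₁, hB₁⟩ := bdd cbp' C.compact_deriv_bp
  have hA₀0 : 0 ≤ A₀ := (abs_nonneg _).trans (hA₀ 0)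
  have hA₁0 : 0 ≤ A₁ := (abs_nonneg _).trans (hA₁ 0)
  have I₀ {β : ℝ → ℝ} (hβ : Continuous β) {B : ℝ} (hB : ∀ x, |β x| ≤ B) :
      Integrable (fun q => Dv q 0 * tensor a β (deriv bp) q) (volume.restrict (film h)) := by
    refine (iD 0).mul_bdd (c := A₀ * B * B₁) (Continuous.aestronglyMeasurable ?_) ?_
    · unfold tensor; fun_prop
    · refine Eventually.of_forall fun q => ?_
      rw [tensor, Real.norm_eq_abs, abs_mul, abs_mul]
      have := (abs_nonneg _).trans (hB 0)
      gcongr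
      exacts [hA₀ _, hB _, hB₁ _]
  have I₂ {β : ℝ → ℝ} (hβ : Continuous β) {B : ℝ} (hB : ∀ x, |β x| ≤ B) :
      Integrable (fun q => Dv q 2 * tensor (deriv a) β bp q) (volume.restrict (film h)) := by
    refine (iD 2).mul_bdd (c := A₁ * B * M) (Continuous.aestronglyMeasurable ?_) ?_
    · unfold tensor; fun_prop
    · refine (ae_restrict_mem hm).mono fun q hq => ?_
      rw [tensor, Real.norm_eq_abs, abs_mul, abs_mul]
      have := (abs_nonneg _).trans (hB 0)
      gcongr
      exacts [hA₁ _, hB _, hbM _ hq.1]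
  set w : Space → ℝ := (film h).indicator (fun q =>
      Dv q 0 * (a q.1.1 * deriv bp q.2) - Dv q 2 * (deriv a q.1.1 * bp q.2)) with hw
  have iw : Integrable w (volume.prod volume) := by
    rw [hw]
    refine (integrable_indicator_iff hm).2 ?_
    refine ((I₀ (β := fun _ => 1) continuous_const (B := 1) (by simp)).sub
      (I₂ (β := fun _ => 1) continuous_const (B := 1) (by simp))).congr
      (Eventually.of_forall fun q => ?_)
    simp [tensor]
  have iW : Integrable (fun p : ℝ × ℝ => ∫ z, w (p, z)) (volume.prod volume) :=
    iw.integral_prod_left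
  have ig : Integrable fun y : ℝ => ∫ x : ℝ, ∫ z, w ((x, y), z) := iW.integral_prod_right
  -- `Cutoff.green` allows only `β` supported over good ordinates, so the fundamental lemma is
  -- applied on that open set.
  have hloc : LocallyIntegrableOn (fun y : ℝ => (∫ x : ℝ, ∫ z, w ((x, y), z)) + ∫ x, a x)
      (goodOrdinates h j k) :=
    (ig.locallyIntegrable.add (locallyIntegrable_const _)).locallyIntegrableOn _
  have key := (isOpen_goodOrdinates hh j k).ae_eq_zero_of_integral_contDiff_smul_eq_zero hloc
    fun β hβ hβc hβs => ?_
  · filter_upwards [key] with y hy hyg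
    exact eq_neg_of_add_eq_zero_left (hy hyg)
  obtain ⟨B, hB⟩ := bdd hβ.continuous hβc
  have iβ : Integrable β := hβ.continuous.integrable_of_hasCompactSupport hβc
  have hβw : ∀ q, β q.1.2 * w q = (film h).indicator (fun q =>
      Dv q 0 * tensor a β (deriv bp) q - Dv q 2 * tensor (deriv a) β bp q) q := by
    intro q
    by_cases hq : q ∈ film h
    · rw [hw, Set.indicator_of_mem hq, Set.indicator_of_mem hq]; simp only [tensor]; ring
    · rw [hw, Set.indicator_of_notMem hq, Set.indicator_of_notMem hq, mul_zero]
  have iβw : Integrable (fun q : Space => β q.1.2 * w q) (volume.prod volume) := by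
    simp_rw [hβw]
    exact (integrable_indicator_iff hm).2 ((I₀ hβ.continuous hB).sub (I₂ hβ.continuous hB))
  have e1 : ∫ y, β y * ∫ x, ∫ z, w ((x, y), z) = ∫ q : Space, β q.1.2 * w q := by
    have i2 : Integrable (fun p : ℝ × ℝ => ∫ z, β p.2 * w (p, z)) (volume.prod volume) :=
      iβw.integral_prod_left
    calc ∫ y, β y * ∫ x, ∫ z, w ((x, y), z) = ∫ y, ∫ x, ∫ z, β y * w ((x, y), z) := by
          simp_rw [integral_const_mul]
      _ = ∫ p : ℝ × ℝ, ∫ z, β p.2 * w (p, z) := (integral_prod_symm _ i2).symm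
      _ = _ := (integral_prod _ iβw).symm
  have e2 : ∫ q : Space, β q.1.2 * w q = -((∫ x, a x) * ∫ y, β y) := by
    simp_rw [hβw]
    rw [integral_indicator hm, integral_sub (I₀ hβ.continuous hB) (I₂ hβ.continuous hB)]
    exact C.green hh hv ht hβ hβc hβs
  simp_rw [smul_eq_mul, mul_add]
  have i3 : Integrable fun y => β y * ∫ x, ∫ z, w ((x, y), z) :=
    ig.bdd_mul hβ.continuous.aestronglyMeasurable (Eventually.of_forall hB)
  rw [integral_add i3 (iβ.mul_const _), e1, e2, integral_mul_const]
  ring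

end Cutoff

theorem deriv_comp_mul_add {f : ℝ → ℝ} (hf : Differentiable ℝ f) (r s x : ℝ) :
    deriv (fun x => f (r * x + s)) x = r * deriv f (r * x + s) := by
  have h1 : HasDerivAt (fun x => r * x + s) r x := by
    simpa using ((hasDerivAt_id x).const_mul r).add_const s
  rw [mul_comm]
  exact ((hf _).hasDerivAt.comp x h1).deriv

theorem exists_cutoff : ∃ M m : ℝ, 0 < M ∧ 0 < m ∧ ∀ j k : ℤ, ∃ a bp b : ℝ → ℝ,
    Cutoff j k a bp b ∧ ∫ x, a x = m * 2 ^ j ∧ (∀ x, |a x| ≤ 1) ∧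
      (∀ x, |deriv a x| ≤ M / 2 ^ j) ∧ (∀ z, |bp z| ≤ 1) ∧ ∀ z, |deriv bp z| ≤ M / 2 ^ j := by
  -- The support lies in `[1/4, 3/4]`, so its rescaled copies stay away from the ends of the
  -- half-open cells.
  set A : ContDiffBump (1 / 2 : ℝ) := ⟨1 / 8, 1 / 4, by norm_num, by norm_num⟩ with hA
  have hAs : ContDiff ℝ ∞ A := A.contDiff
  set S := Real.smoothTransition with hS
  have hSs : ContDiff ℝ ∞ S := Real.smoothTransition.contDiff
  obtain ⟨M₁, hM₁⟩ := (hAs.continuous_deriv (by simp)).bounded_above_of_compact_support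
    A.hasCompactSupport.deriv
  obtain ⟨M₂, hM₂⟩ := exists_bound_deriv_smoothTransition
  have hM₁0 : 0 ≤ M₁ := (norm_nonneg _).trans (hM₁ 0)
  have hM₂0 : 0 ≤ M₂ := (norm_nonneg _).trans (hM₂ 0)
  refine ⟨M₁ + 3 * M₂ + 1, ∫ x, A x, by positivity, A.integral_pos, fun j k => ?_⟩
  obtain ⟨R, hR⟩ : ∃ R : ℝ, R = 2 ^ j := ⟨_, rfl⟩
  have hR0 : 0 < R := by rw [hR]; positivity
  have hbp : ContDiff ℝ ∞ fun z => S (-3 / R * z + 2) := hSs.comp (by fun_prop)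
  have hbp1 (z : ℝ) (hz : z ≤ R / 3) : S (-3 / R * z + 2) = 1 := by
    refine Real.smoothTransition.one_of_one_le ?_
    have : z / R ≤ 1 / 3 := by rw [div_le_iff₀ hR0]; linarith
    have h' : -3 / R * z = -3 * (z / R) := by ring
    linarith
  have hbp0 (z : ℝ) (hz : 2 * R / 3 ≤ z) : S (-3 / R * z + 2) = 0 := by
    refine Real.smoothTransition.zero_of_nonpos ?_
    have : 2 / 3 ≤ z / R := by rw [le_div_iff₀ hR0]; linarith
    have h' : -3 / R * z = -3 * (z / R) := by ring
    linarith
  have hbm1 (z : ℝ) (hz : 0 ≤ z) : S (3 / R * z + 2) = 1 := by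
    refine Real.smoothTransition.one_of_one_le ?_
    have : 0 ≤ 3 / R * z := by positivity
    linarith
  have hbm0 (z : ℝ) (hz : z ≤ -R) : S (3 / R * z + 2) = 0 := by
    refine Real.smoothTransition.zero_of_nonpos ?_
    have : z / R ≤ -1 := by rw [div_le_iff₀ hR0]; linarith
    have h' : 3 / R * z = 3 * (z / R) := by ring
    linarith
  have hsupp : tsupport (fun z => S (-3 / R * z + 2) * S (3 / R * z + 2)) ⊆
      Set.Icc (-R) (2 * R / 3) := by
    refine closure_minimal (fun z hz => ?_) isClosed_Icc
    rw [Function.mem_support] at hz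
    constructor
    · by_contra! h0; exact right_ne_zero_of_mul hz (hbm0 z h0.le)
    · by_contra! h0; exact left_ne_zero_of_mul hz (hbp0 z h0.le)
  -- The vertical cutoff drops from 1 to 0 between `R/3` and `2R/3`. The extra factor in the last
  -- function is 1 for `z ≥ 0` and vanishes for `z ≤ -R`, which makes the support compact.
  refine ⟨fun x => A (1 / R * x + -k), fun z => S (-3 / R * z + 2),
    fun z => S (-3 / R * z + 2) * S (3 / R * z + 2), ?_, ?_, ?_, ?_, ?_, ?_⟩
  · constructor
    · exact hAs.comp (by fun_prop)
    · exact hbp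
    · exact hbp.mul (hSs.comp (by fun_prop))
    · exact isCompact_Icc.of_isClosed_subset (isClosed_tsupport _) hsupp
    · have h1 : tsupport (fun x => A (1 / R * x + -k)) ⊆
          Set.Icc ((k + 1 / 4) * R) ((k + 3 / 4) * R) := by
        refine closure_minimal (fun x hx => ?_) isClosed_Icc
        have hx' : 1 / R * x + -k ∈ Function.support A := hx
        rw [A.support_eq, Metric.mem_ball, Real.dist_eq, abs_lt] at hx'
        have hxR : 1 / R * x = x / R := by ring
        rw [hxR] at hx'
        constructor
        · rw [← le_div_iff₀ hR0]
          have : -(1 / 4 : ℝ) < x / R + -k - 1 / 2 := hx'.1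
          linarith
        · rw [← div_le_iff₀ hR0]
          have : x / R + -k - 1 / 2 < (1 / 4 : ℝ) := hx'.2
          linarith
      refine h1.trans fun x hx => ?_
      rw [cell, ← hR]
      constructor <;> nlinarith [hx.1, hx.2]
    · intro z hz
      have := (hsupp hz).2
      rw [← hR]; linarith
    · rw [← hR]
      have h1 : tsupport (deriv fun z => S (-3 / R * z + 2)) ⊆ Set.Icc (R / 3) (2 * R / 3) := by
        refine closure_minimal (fun z hz => ?_) isClosed_Icc
        constructor
        · by_contra! h0
          refine hz ?_
          have h' : (fun z => S (-3 / R * z + 2)) =ᶠ[𝓝 z] fun _ => 1 :=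
            (eventually_lt_nhds h0).mono fun t ht => hbp1 t ht.le
          rw [h'.deriv_eq, deriv_const]
        · by_contra! h0
          refine hz ?_
          have h' : (fun z => S (-3 / R * z + 2)) =ᶠ[𝓝 z] fun _ => 0 :=
            (eventually_gt_nhds h0).mono fun t ht => hbp0 t ht.le
          rw [h'.deriv_eq, deriv_const]
      refine h1.trans fun z hz => ?_
      constructor <;> linarith [hz.1, hz.2]
    · intro z hz
      rw [← hR] at hz
      exact hbp0 z (by linarith)
    · intro z hz
      simp only [hbm1 z hz.le, mul_one]
    · simp only [hbm1 0 le_rfl, mul_one]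
      exact hbp1 0 (by positivity)
  · rw [Measure.integral_comp_mul_left (fun x => A (x + -k)), integral_add_right_eq_self (fun x => A x),
      smul_eq_mul, abs_of_pos (by positivity), ← hR]
    field_simp
  · intro x
    rw [abs_of_nonneg A.nonneg]
    exact A.le_one
  · intro x
    rw [deriv_comp_mul_add (hAs.differentiable (by simp)), abs_mul, ← hR,
      abs_of_pos (by positivity : 0 < 1 / R), one_div_mul_eq_div]
    gcongr
    exact (hM₁ _).trans (by linarith)
  · intro z
    rw [abs_of_nonneg (Real.smoothTransition.nonneg _)]
    exact Real.smoothTransition.le_one _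
  · intro z
    rw [deriv_comp_mul_add (hSs.differentiable (by simp)), abs_mul, ← hR, abs_div, abs_of_pos hR0,
      div_mul_eq_mul_div]
    gcongr
    rw [abs_neg, abs_of_pos (by norm_num : (0 : ℝ) < 3)]
    have : |deriv S (-3 / R * z + 2)| ≤ M₂ := hM₂ _
    linarith

/-- The elastic energy per unit area. -/
noncomputable def columnEnergy (h : Plane → ℝ) (Du : Space → Fin 2 → Fin 3 → ℝ) (s : Plane) :
    ℝ≥0∞ :=
  ∫⁻ z, (film h).indicator (fun q => ENNReal.ofReal (∑ i, ∑ j, (Du q i j) ^ 2)) (s, z)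

/-- Young's inequality replaces Cauchy–Schwarz, so that the strain can be bounded pointwise before
integration. -/
theorem strain_le {P Q N θ η : ℝ} (hη : 0 < η) (hθ : N ^ 2 ≤ 2 * η * θ) {x y : ℝ}
    (hx : |x| ≤ N) (hy : |y| ≤ N) : |P * x - Q * y| ≤ θ * (P ^ 2 + Q ^ 2) + η := by
  have h1 (T : ℝ) : |T| * N ≤ θ * T ^ 2 + η / 2 := by
    have h2 : 0 ≤ (2 * η * θ - N ^ 2) * T ^ 2 :=
      mul_nonneg (by linarith) (sq_nonneg T)
    have h3 : 0 ≤ (|T| * N - η) ^ 2 := sq_nonneg _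
    have h4 : |T| ^ 2 = T ^ 2 := sq_abs T
    have h5 : 2 * η * (|T| * N) ≤ 2 * η * (θ * T ^ 2 + η / 2) := by nlinarith
    exact le_of_mul_le_mul_left h5 (by positivity)
  calc |P * x - Q * y| ≤ |P * x| + |Q * y| := abs_sub _ _
    _ ≤ |P| * N + |Q| * N := by rw [abs_mul, abs_mul]; gcongr
    _ ≤ _ := by linarith [h1 P, h1 Q]

theorem exists_ae_cellEnergyBound : ∃ c : ℝ, 0 < c ∧ ∀ (V : ℝ) (h : Plane → ℝ)
    (Dh : Plane → Fin 2 → ℝ) (u : Fin 2 → Space → ℝ) (Du : Space → Fin 2 → Fin 3 → ℝ),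
    Admissible V h Dh u Du → ∀ᵐ y : ℝ, CellEnergyBound (ENNReal.ofReal c) (fun x => h (x, y))
      fun x => columnEnergy h Du (x, y) := by
  obtain ⟨M, m, hM, hm, hcut⟩ := exists_cutoff
  refine ⟨m ^ 2 / (2 * M ^ 2), by positivity, fun V h Dh u Du H => ?_⟩
  have hh := H.continuous_profile
  refine ae_all_iff.2 fun j => ae_all_iff.2 fun k => ?_
  obtain ⟨a, bp, b, C, hai, ha1, hadM, hbp1, hbpdM⟩ := hcut j k
  filter_upwards [C.ae_slice hh H.integrable_profile (H.sobolev_displacement 0) H.trace_fst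
    (M := 1) fun z _ => hbp1 z] with y hy hgood
  specialize hy hgood
  obtain ⟨R, hR⟩ : ∃ R : ℝ, R = 2 ^ j := ⟨_, rfl⟩
  have hR0 : 0 < R := by rw [hR]; positivity
  rw [← hR] at hai hadM hbpdM ⊢
  set e : Space → ℝ≥0∞ :=
    (film h).indicator (fun q => ENNReal.ofReal (∑ i, ∑ j, (Du q i j) ^ 2)) with he
  set w : Space → ℝ := (film h).indicator (fun q =>
      Du q 0 0 * (a q.1.1 * deriv bp q.2) - Du q 0 2 * (deriv a q.1.1 * bp q.2)) with hw
  -- `η` is chosen so that its integral over the `R × R` square is `m R / 2`, half of `∫ a`; `θ` is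
  -- then fixed by `2 η θ = (M/R)²`.
  set θ := M ^ 2 / (m * R) with hθ
  set η := m / (2 * R) with hη
  have hθ0 : 0 < θ := by positivity
  have hη0 : 0 < η := by positivity
  have hpt (x z : ℝ) : ‖w ((x, y), z)‖ₑ ≤ (cell j k).indicator (fun x =>
      ENNReal.ofReal θ * e ((x, y), z) +
        (Set.Ioo 0 R).indicator (fun _ => ENNReal.ofReal η) z) x := by
    by_cases hq : ((x, y), z) ∈ film h
    swap
    · rw [hw, Set.indicator_of_notMem hq]; simp
    by_cases hx : x ∈ cell j k
    swap
    · have h1 : a x = 0 := image_eq_zero_of_notMem_tsupport fun h => hx (C.tsupport_a h)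
      have h2 : deriv a x = 0 := image_eq_zero_of_notMem_tsupport fun h =>
        hx (C.tsupport_a (tsupport_deriv_subset h))
      rw [hw, Set.indicator_of_mem hq]; simp [h1, h2]
    rw [Set.indicator_of_mem hx]
    by_cases hz : z < R
    swap
    · have h1 : bp z = 0 := C.bp_eq_zero z (by rw [← hR]; exact not_lt.1 hz)
      have h2 : deriv bp z = 0 := image_eq_zero_of_notMem_tsupport fun h =>
        hz (by rw [hR]; exact (C.tsupport_deriv_bp h).2)
      rw [hw, Set.indicator_of_mem hq]; simp [h1, h2]
    have hz0 : z ∈ Set.Ioo 0 R := ⟨hq.1, hz⟩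
    rw [hw, he, Set.indicator_of_mem hq, Set.indicator_of_mem hq, Set.indicator_of_mem hz0,
      ← ENNReal.ofReal_mul hθ0.le, ← ENNReal.ofReal_add (by positivity) hη0.le, ← ofReal_norm,
      Real.norm_eq_abs]
    refine ENNReal.ofReal_le_ofReal ((strain_le (N := M / R) (θ := θ) hη0 ?_ ?_ ?_).trans
      ?_)
    · rw [hθ, hη]; apply le_of_eq; field_simp
    · rw [abs_mul]
      calc |a x| * |deriv bp z| ≤ 1 * (M / R) := by gcongr; exacts [ha1 x, hbpdM z]
        _ = _ := one_mul _
    · rw [abs_mul]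
      calc |deriv a x| * |bp z| ≤ M / R * 1 := by gcongr; exacts [hadM x, hbp1 z]
        _ = _ := mul_one _
    · gcongr
      simp only [Fin.sum_univ_two, Fin.sum_univ_three]
      nlinarith [sq_nonneg (Du ((x, y), z) 0 1), sq_nonneg (Du ((x, y), z) 1 0),
        sq_nonneg (Du ((x, y), z) 1 1), sq_nonneg (Du ((x, y), z) 1 2)]
  have hpt2 (x : ℝ) : ‖∫ z, w ((x, y), z)‖ₑ ≤ (cell j k).indicator (fun x =>
      ENNReal.ofReal θ * columnEnergy h Du (x, y) + ENNReal.ofReal (η * R)) x := by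
    refine (enorm_integral_le_lintegral_enorm _).trans ((lintegral_mono (hpt x)).trans ?_)
    by_cases hx : x ∈ cell j k
    · simp only [Set.indicator_of_mem hx]
      rw [lintegral_add_right _ (measurable_const.indicator measurableSet_Ioo),
        lintegral_const_mul' _ _ ENNReal.ofReal_ne_top, lintegral_indicator_const measurableSet_Ioo,
        Real.volume_Ioo, sub_zero, ← ENNReal.ofReal_mul hη0.le]
      rfl
    · simp [Set.indicator_of_notMem hx]
  -- The last term absorbs half of the left side; the other half yields energy at least `m² R² / (2
  -- M²)`.
  have hmain : ENNReal.ofReal (m * R) ≤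
      ENNReal.ofReal θ * (∫⁻ x in cell j k, columnEnergy h Du (x, y)) +
        ENNReal.ofReal (m * R / 2) := by
    calc ENNReal.ofReal (m * R) = ‖∫ x, ∫ z, w ((x, y), z)‖ₑ := by
          rw [hy, hai, enorm_neg, ← ofReal_norm, Real.norm_eq_abs, abs_of_pos (by positivity)]
      _ ≤ ∫⁻ x, ‖∫ z, w ((x, y), z)‖ₑ := enorm_integral_le_lintegral_enorm _
      _ ≤ _ := lintegral_mono hpt2
      _ = _ := by
        rw [lintegral_indicator (measurableSet_cell j k), lintegral_add_right _ measurable_const,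
          lintegral_const_mul' _ _ ENNReal.ofReal_ne_top, setLIntegral_const, volume_cell, ← hR,
          ← ENNReal.ofReal_mul (by positivity)]
        congr 2
        rw [hη]; field_simp
  by_cases htop : ∫⁻ x in cell j k, columnEnergy h Du (x, y) = ⊤
  · rw [htop]; exact le_top
  obtain ⟨E, hE0, hE⟩ : ∃ E : ℝ, 0 ≤ E ∧
      ∫⁻ x in cell j k, columnEnergy h Du (x, y) = ENNReal.ofReal E :=
    ⟨_, ENNReal.toReal_nonneg, (ENNReal.ofReal_toReal htop).symm⟩
  rw [hE, ← ENNReal.ofReal_mul hθ0.le, ← ENNReal.ofReal_add (by positivity) (by positivity),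
    ENNReal.ofReal_le_ofReal_iff (by positivity)] at hmain
  rw [hE, ← ENNReal.ofReal_mul hR0.le, ← ENNReal.ofReal_mul (by positivity)]
  apply ENNReal.ofReal_le_ofReal
  have h1 : m * R / 2 ≤ M ^ 2 / (m * R) * E := by rw [hθ] at hmain; linarith
  rw [div_mul_eq_mul_div, le_div_iff₀ (by positivity)] at h1
  rw [div_mul_eq_mul_div, div_le_iff₀ (by positivity)]
  nlinarith

/-! ### Symmetry under exchange of the horizontal coordinates. -/

theorem IsSobolev.comp_equiv {E : Type*} [NormedAddCommGroup E] [NormedSpace ℝ E]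
    [MeasureSpace E] [BorelSpace E] {n : ℕ} {e : Fin n → E} {Ω : Set E} {p : ℝ≥0∞} {f : E → ℝ}
    {G : E → Fin n → ℝ} (H : IsSobolev e Ω p f G) (L : E ≃L[ℝ] E)
    (hL : MeasurePreserving L) (π : Fin n → Fin n) (hπ : ∀ j, L (e j) = e (π j)) :
    IsSobolev e (L ⁻¹' Ω) p (f ∘ L) fun x j => G (L x) (π j) := by
  have hemb : MeasurableEmbedding L := L.toHomeomorph.measurableEmbedding
  have hres : MeasurePreserving L (volume.restrict (L ⁻¹' Ω)) (volume.restrict Ω) :=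
    hL.restrict_preimage_emb hemb Ω
  refine ⟨H.memLp.comp_measurePreserving hres,
    fun j => (H.memLp_grad (π j)).comp_measurePreserving hres, fun j φ hφ hφc hφs => ?_⟩
  have hψ : ContDiff ℝ ∞ (φ ∘ L.symm) := hφ.comp L.symm.contDiff
  have hφψ : φ = (φ ∘ L.symm) ∘ L := by ext x; simp
  have hψs : tsupport (φ ∘ L.symm) ⊆ Ω := by
    rw [show φ ∘ L.symm = φ ∘ L.symm.toHomeomorph from rfl,
      tsupport_comp_eq_preimage φ L.symm.toHomeomorph]
    intro x hx
    have : L (L.symm x) ∈ Ω := hφs hx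
    simpa using this
  have hw := H.weak_grad (π j) _ hψ (hφc.comp_homeomorph L.symm.toHomeomorph) hψs
  have e1 : ∫ x in L ⁻¹' Ω, (f ∘ L) x * fderiv ℝ φ x (e j) =
      ∫ x in Ω, f x * fderiv ℝ (φ ∘ L.symm) x (e (π j)) := by
    rw [← hL.setIntegral_preimage_emb hemb
      (fun x => f x * fderiv ℝ (φ ∘ L.symm) x (e (π j))) Ω]
    congr 1; ext x
    conv_lhs => rw [hφψ, L.comp_right_fderiv]
    simp [hπ]
  have e2 : ∫ x in L ⁻¹' Ω, G (L x) (π j) * φ x = ∫ x in Ω, G x (π j) * (φ ∘ L.symm) x := by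
    rw [← hL.setIntegral_preimage_emb hemb (fun x => G x (π j) * (φ ∘ L.symm) x) Ω]
    simp
  rw [e1, e2, hw]

/-- The exchange of the two coordinates of the plane. -/
def swapPlane : Plane ≃L[ℝ] Plane := ContinuousLinearEquiv.prodComm ℝ ℝ ℝ

/-- The exchange of the two horizontal coordinates of space. -/
def swapSpace : Space ≃L[ℝ] Space := swapPlane.prodCongr (ContinuousLinearEquiv.refl ℝ ℝ)

theorem swapSpace_apply (s : Plane) (z : ℝ) : swapSpace (s, z) = (s.swap, z) := rfl

theorem measurePreserving_swapPlane : MeasurePreserving swapPlane :=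
  Measure.measurePreserving_swap (μ := (volume : Measure ℝ)) (ν := (volume : Measure ℝ))

theorem measurePreserving_swapSpace : MeasurePreserving swapSpace :=
  measurePreserving_swapPlane.prod (MeasurePreserving.id (volume : Measure ℝ))

theorem HasBottomTrace.swap {h : Plane → ℝ} {v vz : Space → ℝ} {g : Plane → ℝ}
    (H : HasBottomTrace h v vz g) :
    HasBottomTrace (h ∘ Prod.swap) (v ∘ swapSpace) (vz ∘ swapSpace) (g ∘ Prod.swap) := by
  intro φ hφ hφc hφs
  have hemb : MeasurableEmbedding swapSpace := swapSpace.toHomeomorph.measurableEmbedding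
  have hψ : ContDiff ℝ ∞ (φ ∘ swapSpace) := hφ.comp swapSpace.contDiff
  have hφψ : φ = (φ ∘ swapSpace) ∘ swapSpace := rfl
  have hψs : tsupport (φ ∘ swapSpace) ⊆ filmBelow h := by
    rw [show φ ∘ swapSpace = φ ∘ swapSpace.toHomeomorph from rfl,
      tsupport_comp_eq_preimage φ swapSpace.toHomeomorph]
    exact fun x hx => hφs hx
  have hfilm : film (h ∘ Prod.swap) = swapSpace ⁻¹' film h := rfl
  have hw := H _ hψ (hφc.comp_homeomorph swapSpace.toHomeomorph) hψs
  have e1 : ∫ q in film (h ∘ Prod.swap), (v ∘ swapSpace) q * fderiv ℝ φ q (dir3 2) =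
      ∫ q in film h, v q * fderiv ℝ (φ ∘ swapSpace) q (dir3 2) := by
    rw [hfilm, ← measurePreserving_swapSpace.setIntegral_preimage_emb hemb]
    congr 1; ext x
    conv_lhs => rw [hφψ, swapSpace.comp_right_fderiv]
    rfl
  have e2 : ∫ q in film (h ∘ Prod.swap), (vz ∘ swapSpace) q * φ q =
      ∫ q in film h, vz q * (φ ∘ swapSpace) q := by
    rw [hfilm, ← measurePreserving_swapSpace.setIntegral_preimage_emb hemb]
    rfl
  have e3 : ∫ s : Plane, (g ∘ Prod.swap) s * φ (s, 0) =
      ∫ s : Plane, g s * (φ ∘ swapSpace) (s, 0) :=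
    measurePreserving_swapPlane.integral_comp swapPlane.toHomeomorph.measurableEmbedding
      fun s : Plane => g s * (φ ∘ swapSpace) (s, 0)
  rw [e1, e2, e3, hw]

/-- Configurations with exchanged horizontal coordinates are admissible. -/
theorem Admissible.swap {V : ℝ} {h : Plane → ℝ} {Dh : Plane → Fin 2 → ℝ}
    {u : Fin 2 → Space → ℝ} {Du : Space → Fin 2 → Fin 3 → ℝ} (H : Admissible V h Dh u Du) :
    Admissible V (h ∘ Prod.swap) (fun s j => Dh s.swap (Equiv.swap 0 1 j))
      (fun i => u (Equiv.swap 0 1 i) ∘ swapSpace)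
      (fun q i j => Du (swapSpace q) (Equiv.swap 0 1 i) (Equiv.swap 0 1 j)) where
  continuous_profile := H.continuous_profile.comp continuous_swap
  profile_nonneg s := H.profile_nonneg _
  sobolev_profile := H.sobolev_profile.comp_equiv swapPlane measurePreserving_swapPlane
    (Equiv.swap 0 1) fun j => by fin_cases j <;> rfl
  integrable_profile := measurePreserving_swapPlane.integrable_comp_of_integrable
    H.integrable_profile
  volume_eq := (measurePreserving_swapPlane.integral_comp
    swapPlane.toHomeomorph.measurableEmbedding h).trans H.volume_eq
  sobolev_displacement i := (H.sobolev_displacement (Equiv.swap 0 1 i)).comp_equiv swapSpace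
    measurePreserving_swapSpace (Equiv.swap 0 1) fun j => by fin_cases j <;> rfl
  trace_fst := H.trace_snd.swap
  trace_snd := H.trace_fst.swap

theorem columnEnergy_swap (h : Plane → ℝ) (Du : Space → Fin 2 → Fin 3 → ℝ) :
    (columnEnergy (h ∘ Prod.swap) fun q i j =>
      Du (swapSpace q) (Equiv.swap 0 1 i) (Equiv.swap 0 1 j)) =
      columnEnergy h Du ∘ Prod.swap := by
  ext s
  simp only [columnEnergy, Function.comp_apply]
  congr 1; ext z
  by_cases hz : (s.swap, z) ∈ film h
  · rw [Set.indicator_of_mem hz, Set.indicator_of_mem (show (s, z) ∈ film (h ∘ Prod.swap) from hz),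
      swapSpace_apply]
    congr 1
    rw [Equiv.sum_comp (Equiv.swap (0 : Fin 2) 1) fun i =>
      ∑ j, Du (s.swap, z) i (Equiv.swap 0 1 j) ^ 2]
    exact Finset.sum_congr rfl fun i _ =>
      Equiv.sum_comp (Equiv.swap (0 : Fin 3) 1) fun j => Du (s.swap, z) i j ^ 2
  · rw [Set.indicator_of_notMem hz,
      Set.indicator_of_notMem (show (s, z) ∉ film (h ∘ Prod.swap) from hz)]

/-! ### Assembly of the lower bound. -/

section Admissible

variable {V : ℝ} {h : Plane → ℝ} {Dh : Plane → Fin 2 → ℝ} {u : Fin 2 → Space → ℝ}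
  {Du : Space → Fin 2 → Fin 3 → ℝ}

theorem Admissible.aemeasurable_density (H : Admissible V h Dh u Du) :
    AEMeasurable ((film h).indicator fun q => ENNReal.ofReal (∑ i, ∑ j, (Du q i j) ^ 2)) := by
  refine (aemeasurable_indicator_iff (measurableSet_film H.continuous_profile)).2
    (AEMeasurable.ennreal_ofReal ?_)
  exact Finset.aemeasurable_fun_sum _ fun i _ => Finset.aemeasurable_fun_sum _ fun j _ =>
    ((H.sobolev_displacement i).memLp_grad j).aestronglyMeasurable.aemeasurable.pow_const 2

theorem Admissible.aemeasurable_columnEnergy (H : Admissible V h Dh u Du) :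
    AEMeasurable (columnEnergy h Du) :=
  AEMeasurable.lintegral_prod_right' (μ := (volume : Measure Plane)) (ν := (volume : Measure ℝ))
    H.aemeasurable_density

theorem Admissible.lintegral_columnEnergy (H : Admissible V h Dh u Du) :
    ∫⁻ s, columnEnergy h Du s =
      ∫⁻ q in film h, ENNReal.ofReal (∑ i, ∑ j, (Du q i j) ^ 2) := by
  rw [← lintegral_indicator (measurableSet_film H.continuous_profile), Measure.volume_eq_prod]
  exact (lintegral_prod _ H.aemeasurable_density).symm

theorem Admissible.sliceBounds (H : Admissible V h Dh u Du) {c : ℝ≥0∞}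
    (hc : ∀ᵐ y : ℝ, CellEnergyBound c (fun x => h (x, y)) fun x => columnEnergy h Du (x, y)) :
    SliceBounds c h (columnEnergy h Du) fun s => ‖Dh s 0‖ₑ where
  continuous := H.continuous_profile
  aemeasurable_energy := H.aemeasurable_columnEnergy
  aemeasurable_slope := by
    simpa using (H.sobolev_profile.memLp_grad 0).aestronglyMeasurable.enorm
  energy_bound := hc
  osc_bound := ae_cellOscBound H.continuous_profile H.sobolev_profile

theorem lintegral_slope_le (Dh : Plane → Fin 2 → ℝ) (i : Fin 2) :
    ∫⁻ s, ‖Dh s i‖ₑ ^ 2 ≤ ∫⁻ s, ENNReal.ofReal (∑ j, (Dh s j) ^ 2) := by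
  refine lintegral_mono fun s => ?_
  rw [← ofReal_norm, ← ENNReal.ofReal_pow (norm_nonneg _), Real.norm_eq_abs, sq_abs]
  exact ENNReal.ofReal_le_ofReal
    (Finset.single_le_sum (f := fun j => Dh s j ^ 2) (fun j _ => sq_nonneg _) (Finset.mem_univ i))

theorem lintegral_slope_swap_le (Dh : Plane → Fin 2 → ℝ) :
    ∫⁻ s : Plane, ‖Dh s.swap (Equiv.swap 0 1 0)‖ₑ ^ 2 ≤
      ∫⁻ s, ENNReal.ofReal (∑ j, (Dh s j) ^ 2) :=
  (SliceBounds.lintegral_comp_swap fun s => ‖Dh s 1‖ₑ ^ 2).trans_le (lintegral_slope_le Dh 1)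

end Admissible

/-- For `e ≤ 1` the sixth power dominates and bounds `V`; for `e ≥ 1` the seventh dominates, and
raising to the power `6/7` gives `e ^ 6`. -/
theorem min_rpow_le {C V e : ℝ} (hC : 1 ≤ C) (hV : 0 < V) (he : 0 ≤ e)
    (h : V ≤ C * (e ^ 6 + e ^ 7)) : min V (V ^ (6 / 7 : ℝ)) ≤ 2 * C * e ^ 6 := by
  rcases le_total e 1 with h1 | h1
  · refine (min_le_left _ _).trans ?_
    have : e ^ 7 ≤ e ^ 6 := pow_le_pow_of_le_one he h1 (by norm_num)
    nlinarith
  · refine (min_le_right _ _).trans ?_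
    have h67 : e ^ 6 ≤ e ^ 7 := pow_le_pow_right₀ h1 (by norm_num)
    have hV' : V ≤ 2 * C * e ^ 7 := by nlinarith
    calc V ^ (6 / 7 : ℝ) ≤ (2 * C * e ^ 7) ^ (6 / 7 : ℝ) := by gcongr
      _ = (2 * C) ^ (6 / 7 : ℝ) * e ^ 6 := by
          rw [Real.mul_rpow (by positivity) (by positivity), ← Real.rpow_natCast e 7,
            ← Real.rpow_mul he, ← Real.rpow_natCast e 6]
          norm_num
      _ ≤ (2 * C) ^ (1 : ℝ) * e ^ 6 := by
          gcongr
          · linarith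
          · norm_num
      _ = _ := by rw [Real.rpow_one]

theorem exists_le_minEnergy : ∃ c : ℝ, 0 < c ∧ ∀ V : ℝ, 0 < V →
    ENNReal.ofReal (c * min V (V ^ (6 / 7 : ℝ))) ≤ minEnergy V := by
  obtain ⟨c, hc, hcell⟩ := exists_ae_cellEnergyBound
  set B := √(16 * (1 / c + 4 / c ^ 2)) * (∑' j : ℤ, (3 / 4 : ℝ) ^ j.natAbs) with hB
  have hB0 : 0 ≤ B := mul_nonneg (Real.sqrt_nonneg _) (tsum_nonneg fun _ => by positivity)
  -- The summand 1 ensures `1 ≤ C`, as `min_rpow_le` requires.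
  set C := 2 * (8 / c + B) + 1 with hC
  have hC1 : 1 ≤ C := by rw [hC]; linarith [show 0 ≤ 2 * (8 / c + B) by positivity]
  refine ⟨1 / (2 * C), by positivity, fun V hV => le_sInf ?_⟩
  rintro E ⟨h, Dh, u, Du, H, rfl⟩
  by_cases htop : energy h Dh Du = ⊤
  · rw [htop]; exact le_top
  -- The sixth root keeps all exponents integral: the elastic energy is `t ^ 3 ≤ e ^ 6`, the slope
  -- bound is `d = e ^ 3`, and `t ^ 2 * d ≤ e ^ 7`.
  set e := (energy h Dh Du).toReal ^ (1 / 6 : ℝ) with he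
  have he0 : 0 ≤ e := Real.rpow_nonneg ENNReal.toReal_nonneg _
  have he6 : energy h Dh Du = ENNReal.ofReal (e ^ 6) := by
    rw [he, ← Real.rpow_natCast, ← Real.rpow_mul ENNReal.toReal_nonneg]
    norm_num [ENNReal.ofReal_toReal htop]
  have hK : ∫⁻ s, columnEnergy h Du s ≤ ENNReal.ofReal (e ^ 6) := by
    rw [H.lintegral_columnEnergy, ← he6, energy]; exact le_self_add
  have hD : ∫⁻ s, ENNReal.ofReal (∑ j, (Dh s j) ^ 2) ≤ ENNReal.ofReal ((e ^ 3) ^ 2) := by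
    rw [← pow_mul, ← he6, energy]; exact le_add_self
  have hKtop : ∫⁻ s, columnEnergy h Du s ≠ ⊤ := ne_top_of_le_ne_top ENNReal.ofReal_ne_top hK
  set t := (∫⁻ s, columnEnergy h Du s).toReal ^ (1 / 3 : ℝ) with ht
  have ht0 : 0 ≤ t := Real.rpow_nonneg ENNReal.toReal_nonneg _
  have ht3 : ∫⁻ s, columnEnergy h Du s = ENNReal.ofReal (t ^ 3) := by
    rw [ht, ← Real.rpow_natCast, ← Real.rpow_mul ENNReal.toReal_nonneg]
    norm_num [ENNReal.ofReal_toReal hKtop]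
  have hte3 : t ^ 3 ≤ e ^ 6 := by
    rw [ht3] at hK
    exact (ENNReal.ofReal_le_ofReal_iff (by positivity)).1 hK
  have hte : t ≤ e ^ 2 := by
    refine le_of_pow_le_pow_left₀ (n := 3) (by norm_num) (by positivity) ?_
    rw [← pow_mul]; exact hte3
  have H₂ := H.swap.sliceBounds (hcell _ _ _ _ _ H.swap)
  rw [columnEnergy_swap] at H₂
  have key := SliceBounds.lintegral_le hc (H.sliceBounds (hcell _ _ _ _ _ H)) H₂ ht0 ht3
    (d := e ^ 3) (by positivity) ((lintegral_slope_le Dh 0).trans hD)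
    ((lintegral_slope_swap_le Dh).trans hD)
  rw [← ofReal_integral_eq_lintegral_ofReal H.integrable_profile
    (Eventually.of_forall H.profile_nonneg), H.volume_eq,
    ENNReal.ofReal_le_ofReal_iff (by positivity)] at key
  rw [he6]
  refine ENNReal.ofReal_le_ofReal ?_
  have hVC : V ≤ C * (e ^ 6 + e ^ 7) := by
    have h1 : t ^ 2 * e ^ 3 ≤ e ^ 7 := by
      calc t ^ 2 * e ^ 3 ≤ (e ^ 2) ^ 2 * e ^ 3 := by gcongr
        _ = e ^ 7 := by ring
    have h2 : 8 / c * t ^ 3 ≤ 8 / c * e ^ 6 := by gcongr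
    have h3 : B * (t ^ 2 * e ^ 3) ≤ B * e ^ 7 := by gcongr
    have h4 : 0 ≤ 8 / c * e ^ 7 := by positivity
    have h5 : 0 ≤ B * e ^ 6 := by positivity
    have h6 : 0 ≤ e ^ 6 + e ^ 7 := by positivity
    rw [hC]; nlinarith
  have := min_rpow_le hC1 hV he0 hVC
  rw [one_div_mul_eq_div, div_le_iff₀ (by positivity)]
  linarith

/-! ### Smooth functions as admissible configurations. -/

theorem isSobolev_of_contDiff {E : Type*} [NormedAddCommGroup E] [NormedSpace ℝ E]
    [FiniteDimensional ℝ E] [MeasureSpace E] [BorelSpace E]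
    [(volume : Measure E).IsAddHaarMeasure] {n : ℕ} {e : Fin n → E} {Ω : Set E} {p : ℝ≥0∞}
    {f : E → ℝ} (hf : ContDiff ℝ ∞ f) (hp : MemLp f p (volume.restrict Ω))
    (hp' : ∀ j, MemLp (fun x => fderiv ℝ f x (e j)) p (volume.restrict Ω)) :
    IsSobolev e Ω p f fun x j => fderiv ℝ f x (e j) := by
  refine ⟨hp, hp', fun j φ hφ hφc hφs => ?_⟩
  have cf' : Continuous fun x => fderiv ℝ f x (e j) :=
    (hf.continuous_fderiv (by simp)).clm_apply continuous_const
  have cφ' : Continuous fun x => fderiv ℝ φ x (e j) :=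
    (hφ.continuous_fderiv (by simp)).clm_apply continuous_const
  have hφ'c : HasCompactSupport fun x => fderiv ℝ φ x (e j) := hφc.fderiv_apply ℝ (e j)
  rw [setIntegral_eq_integral_of_forall_compl_eq_zero,
    setIntegral_eq_integral_of_forall_compl_eq_zero]
  · exact integral_mul_fderiv_eq_neg_fderiv_mul_of_integrable
      ((cf'.mul hφ.continuous).integrable_of_hasCompactSupport hφc.mul_left)
      ((hf.continuous.mul cφ').integrable_of_hasCompactSupport hφ'c.mul_left)
      ((hf.continuous.mul hφ.continuous).integrable_of_hasCompactSupport hφc.mul_left)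
      (fun x _ => hf.differentiable (by simp) x) (fun x _ => hφ.differentiable (by simp) x)
  · intro x hx
    rw [image_eq_zero_of_notMem_tsupport fun h => hx (hφs h), mul_zero]
  · intro x hx
    rw [fderiv_of_notMem_tsupport ℝ fun h => hx (hφs h)]
    simp

instance : (volume : Measure Space).IsAddHaarMeasure :=
  inferInstanceAs ((volume : Measure Plane).prod (volume : Measure ℝ)).IsAddHaarMeasure

theorem memLp_restrict_of_continuous {E : Type*} [NormedAddCommGroup E] [MeasureSpace E]
    [BorelSpace E] [IsFiniteMeasureOnCompacts (volume : Measure E)] [SecondCountableTopology E]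
    {Ω K : Set E} (hΩ : MeasurableSet Ω) (hK : IsCompact K) (hΩK : Ω ⊆ K) {f : E → ℝ}
    (hf : Continuous f) (p : ℝ≥0∞) : MemLp f p (volume.restrict Ω) := by
  have : IsFiniteMeasure (volume.restrict Ω) := ⟨by
    rw [Measure.restrict_apply_univ]
    exact (measure_mono hΩK).trans_lt hK.measure_lt_top⟩
  obtain ⟨C, hC⟩ := hK.exists_bound_of_continuousOn hf.continuousOn
  exact MemLp.of_bound hf.aestronglyMeasurable C
    ((ae_restrict_mem hΩ).mono fun x hx => hC x (hΩK hx))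

/-- The support of `φ` meets `{z > 0}` only inside the film, so both integrals extend to the
half-space, where the fundamental theorem of calculus applies on vertical half-lines. -/
theorem hasBottomTrace_of_contDiff {h : Plane → ℝ} {v : Space → ℝ}
    (hv : ContDiff ℝ ∞ v) :
    HasBottomTrace h v (fun q => fderiv ℝ v q (dir3 2)) fun s => v (s, 0) := by
  intro φ hφ hφc hφs
  have cv' : Continuous fun x => fderiv ℝ v x (dir3 2) :=
    (hv.continuous_fderiv (by simp)).clm_apply continuous_const
  have cφ' : Continuous fun x => fderiv ℝ φ x (dir3 2) :=
    (hφ.continuous_fderiv (by simp)).clm_apply continuous_const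
  have hφ'c : HasCompactSupport fun x => fderiv ℝ φ x (dir3 2) := hφc.fderiv_apply ℝ (dir3 2)
  have i1 : Integrable fun q => v q * fderiv ℝ φ q (dir3 2) :=
    (hv.continuous.mul cφ').integrable_of_hasCompactSupport hφ'c.mul_left
  have i2 : Integrable fun q => fderiv ℝ v q (dir3 2) * φ q :=
    (cv'.mul hφ.continuous).integrable_of_hasCompactSupport hφc.mul_left
  have hsub : film h ⊆ (Set.univ : Set Plane) ×ˢ Set.Ioi (0 : ℝ) := fun q hq => ⟨trivial, hq.1⟩
  have hsum : (∫ q in film h, v q * fderiv ℝ φ q (dir3 2)) +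
      ∫ q in film h, fderiv ℝ v q (dir3 2) * φ q = -∫ s : Plane, v (s, 0) * φ (s, 0) := by
    rw [← integral_add i1.integrableOn i2.integrableOn,
      ← setIntegral_eq_of_subset_of_forall_sdiff_eq_zero
        (MeasurableSet.univ.prod measurableSet_Ioi) hsub, Measure.volume_eq_prod,
      setIntegral_prod (fun q => v q * fderiv ℝ φ q (dir3 2) + fderiv ℝ v q (dir3 2) * φ q)
        (i1.add i2).integrableOn, setIntegral_univ, ← integral_neg]
    · congr 1; ext s
      have hvφ : ContDiff ℝ ∞ fun z : ℝ => v (s, z) * φ (s, z) :=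
        (hv.comp (contDiff_const.prodMk contDiff_id)).mul
          (hφ.comp (contDiff_const.prodMk contDiff_id))
      have hcs : HasCompactSupport fun z : ℝ => φ (s, z) :=
        HasCompactSupport.of_support_subset_isCompact (hφc.isCompact.image continuous_snd)
          fun z hz => ⟨(s, z), subset_tsupport _ hz, rfl⟩
      rw [← HasCompactSupport.integral_Ioi_deriv_eq (hvφ.of_le (by simp)) hcs.mul_left 0]
      congr 1; ext z
      have hvz : DifferentiableAt ℝ (fun z : ℝ => v (s, z)) z :=
        ((hv.comp (contDiff_const.prodMk contDiff_id)).differentiable (by simp)) z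
      have hφz : DifferentiableAt ℝ (fun z : ℝ => φ (s, z)) z :=
        ((hφ.comp (contDiff_const.prodMk contDiff_id)).differentiable (by simp)) z
      rw [fderiv_apply_dir3_two (hv.differentiable (by simp)),
        fderiv_apply_dir3_two (hφ.differentiable (by simp)), deriv_fun_mul hvz hφz]
      ring
    · intro q hq
      have hq' : q ∉ tsupport φ := fun h' => hq.2 ⟨hq.1.2, (hφs h').2⟩
      rw [image_eq_zero_of_notMem_tsupport hq', fderiv_of_notMem_tsupport ℝ hq']
      simp
  linarith

/-! ### Competitors for the upper bound. -/

/-- The linear functional `((x, y), z) ↦ x` or `y`. -/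
noncomputable def horizontal : Fin 2 → Space →L[ℝ] ℝ :=
  ![(ContinuousLinearMap.fst ℝ ℝ ℝ).comp (ContinuousLinearMap.fst ℝ Plane ℝ),
    (ContinuousLinearMap.snd ℝ ℝ ℝ).comp (ContinuousLinearMap.fst ℝ Plane ℝ)]

/-- The displacement that equals the horizontal position up to height `R` and vanishes above
height `2 R`. -/
noncomputable def relaxation (R : ℝ) (i : Fin 2) (q : Space) : ℝ :=
  horizontal i q * Real.smoothTransition (-1 / R * q.2 + 2)

theorem contDiff_relaxation (R : ℝ) (i : Fin 2) : ContDiff ℝ ∞ (relaxation R i) :=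
  (horizontal i).contDiff.mul (Real.smoothTransition.contDiff.comp (by fun_prop))

theorem fderiv_relaxation (R : ℝ) (i : Fin 2) (q w : Space) :
    fderiv ℝ (relaxation R i) q w =
      horizontal i w * Real.smoothTransition (-1 / R * q.2 + 2) +
        horizontal i q * (deriv Real.smoothTransition (-1 / R * q.2 + 2) * (-1 / R * w.2)) := by
  have hS : HasDerivAt Real.smoothTransition (deriv Real.smoothTransition (-1 / R * q.2 + 2))
      (-1 / R * q.2 + 2) :=
    ((Real.smoothTransition.contDiff (n := 1)).differentiable one_ne_zero _).hasDerivAt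
  have h1 : HasFDerivAt (fun q : Space => -1 / R * q.2 + 2)
      ((-1 / R) • ContinuousLinearMap.snd ℝ Plane ℝ) q :=
    (((ContinuousLinearMap.snd ℝ Plane ℝ).hasFDerivAt).const_mul (-1 / R)).add_const 2
  have h2 := (horizontal i).hasFDerivAt (x := q) |>.mul (hS.comp_hasFDerivAt q h1)
  rw [show relaxation R i = ⇑(horizontal i) * (Real.smoothTransition ∘ fun q : Space =>
    -1 / R * q.2 + 2) from rfl, h2.fderiv]
  simp only [_root_.add_apply, _root_.smul_apply, smul_eq_mul,
    Function.comp_apply, ContinuousLinearMap.coe_snd']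
  ring

/-- The cutoff has slope of order `1/R`, but multiplies a position of size at most `2R`, so the
gradient bound is independent of `R`. -/
theorem exists_relaxation_bound : ∃ C : ℝ, 0 < C ∧ ∀ R : ℝ, 0 < R → ∀ q : Space,
    |q.1.1| ≤ 2 * R → |q.1.2| ≤ 2 * R →
      ∑ i, ∑ j, (fderiv ℝ (relaxation R i) q (dir3 j)) ^ 2 ≤
        (Set.Iic (2 * R)).indicator (fun _ => C) q.2 := by
  obtain ⟨M, hM⟩ := exists_bound_deriv_smoothTransition
  have hM0 : 0 ≤ M := (norm_nonneg _).trans (hM 0)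
  refine ⟨6 * (1 + 2 * M) ^ 2, by positivity, fun R hR q hx hy => ?_⟩
  by_cases hq : q.2 ≤ 2 * R
  · rw [Set.indicator_of_mem (show q.2 ∈ Set.Iic (2 * R) from hq)]
    have hbound (i : Fin 2) (j : Fin 3) :
        (fderiv ℝ (relaxation R i) q (dir3 j)) ^ 2 ≤ (1 + 2 * M) ^ 2 := by
      rw [sq_le_sq, abs_of_nonneg (by positivity : 0 ≤ 1 + 2 * M), fderiv_relaxation]
      have h1 : |horizontal i (dir3 j)| ≤ 1 := by
        fin_cases i <;> fin_cases j <;> simp [horizontal, dir3]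
      have h2 : |(dir3 j).2| ≤ 1 := by fin_cases j <;> simp [dir3]
      have h3 : |horizontal i q| ≤ 2 * R := by
        fin_cases i
        · exact hx
        · exact hy
      have h4 : |Real.smoothTransition (-1 / R * q.2 + 2)| ≤ 1 := by
        rw [abs_of_nonneg (Real.smoothTransition.nonneg _)]
        exact Real.smoothTransition.le_one _
      have h5 : |deriv Real.smoothTransition (-1 / R * q.2 + 2)| ≤ M := hM _
      have h6 : |-1 / R| = 1 / R := by rw [abs_div, abs_neg, abs_one, abs_of_pos hR]
      refine (abs_add_le _ _).trans ?_
      simp only [abs_mul]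
      rw [h6]
      calc _ ≤ 1 * 1 + 2 * R * (M * (1 / R * 1)) := by gcongr
        _ = _ := by field_simp
    calc _ ≤ ∑ _i : Fin 2, ∑ _j : Fin 3, (1 + 2 * M) ^ 2 :=
          Finset.sum_le_sum fun i _ => Finset.sum_le_sum fun j _ => hbound i j
      _ = _ := by simp; ring
  · rw [Set.indicator_of_notMem (show q.2 ∉ Set.Iic (2 * R) from hq)]
    have harg : -1 / R * q.2 + 2 ≤ 0 := by
      have : 2 ≤ q.2 / R := by rw [le_div_iff₀ hR]; exact (not_le.1 hq).le
      have h' : -1 / R * q.2 = -(q.2 / R) := by ring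
      linarith
    simp [fderiv_relaxation, Real.smoothTransition.zero_of_nonpos harg,
      deriv_smoothTransition_of_nonpos harg]

/-- The square `[-2 R, 2 R]²`. -/
def square (R : ℝ) : Set Plane := Set.Icc (-(2 * R)) (2 * R) ×ˢ Set.Icc (-(2 * R)) (2 * R)

theorem volume_square {R : ℝ} (hR : 0 < R) : volume (square R) = ENNReal.ofReal (16 * R ^ 2) := by
  rw [square, Measure.volume_eq_prod, Measure.prod_prod, Real.volume_Icc,
    ← ENNReal.ofReal_mul (by linarith)]
  congr 1; ring

theorem measurableSet_square (R : ℝ) : MeasurableSet (square R) :=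
  measurableSet_Icc.prod measurableSet_Icc

/-- Profiles of width `R` with controlled slope. -/
theorem exists_profile : ∃ C : ℝ, 0 < C ∧ ∀ V R : ℝ, 0 < V → 0 < R → ∃ h : Plane → ℝ,
    ContDiff ℝ ∞ h ∧ HasCompactSupport h ∧ (∀ s, 0 ≤ h s) ∧ ∫ s, h s = V ∧
      (∀ s, s ∉ square R → h s = 0) ∧
      ∫⁻ s, ENNReal.ofReal (∑ j, (fderiv ℝ h s (dir2 j)) ^ 2) ≤
        ENNReal.ofReal (C * (V ^ 2 / R ^ 4)) := by
  set η : ContDiffBump (0 : Plane) := ⟨1, 2, one_pos, one_lt_two⟩ with hη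
  have hηs : ContDiff ℝ ∞ η := η.contDiff
  obtain ⟨M, hM⟩ := (hηs.continuous_fderiv (by simp)).bounded_above_of_compact_support
    (η.hasCompactSupport.fderiv ℝ)
  have hM0 : 0 ≤ M := (norm_nonneg _).trans (hM 0)
  obtain ⟨m, hm⟩ : ∃ m, m = ∫ s, η s := ⟨_, rfl⟩
  have hm0 : 0 < m := hm ▸ η.integral_pos
  -- The 32 comes from two partial derivatives on a square of area `16 R²`; the 1 keeps the constant
  -- positive even if `M = 0`.
  refine ⟨32 * M ^ 2 / m ^ 2 + 1, by positivity, fun V R hV hR => ?_⟩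
  set H := V / (m * R ^ 2) with hH
  have hH0 : 0 < H := by positivity
  have hR' : R⁻¹ ≠ 0 := inv_ne_zero hR.ne'
  have hs0 : ContDiff ℝ ∞ fun s : Plane => η (R⁻¹ • s) := hηs.comp (contDiff_const_smul _)
  have hout (s : Plane) (hs : s ∉ square R) : R⁻¹ • s ∉ tsupport η := by
    rw [η.tsupport_eq]
    refine fun h' => hs ?_
    rw [mem_closedBall_zero_iff, norm_smul, norm_inv, Real.norm_eq_abs, abs_of_pos hR,
      inv_mul_le_iff₀ hR, Prod.norm_def, max_le_iff] at h'
    have h1 : |s.1| ≤ R * 2 := h'.1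
    have h2 : |s.2| ≤ R * 2 := h'.2
    rw [abs_le] at h1 h2
    refine ⟨⟨?_, ?_⟩, ⟨?_, ?_⟩⟩ <;> linarith
  have hd (s w : Plane) : fderiv ℝ (fun s : Plane => H * η (R⁻¹ • s)) s w =
      H * (R⁻¹ * fderiv ℝ η (R⁻¹ • s) w) := by
    rw [fderiv_const_mul (hs0.differentiable (by simp) s), fderiv_comp_smul]
    rfl
  refine ⟨fun s => H * η (R⁻¹ • s), contDiff_const.mul hs0,
    (η.hasCompactSupport.comp_smul hR').mul_left, fun s => mul_nonneg hH0.le η.nonneg, ?_, ?_, ?_⟩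
  · rw [integral_const_mul, Measure.integral_comp_smul, ← hm]
    have : Module.finrank ℝ Plane = 2 := by simp [Plane]
    rw [this, abs_of_pos (by positivity), smul_eq_mul, hH]
    field_simp
  · intro s hs
    simp only [image_eq_zero_of_notMem_tsupport (hout s hs), mul_zero]
  · have hpt (s : Plane) : ENNReal.ofReal (∑ j, (fderiv ℝ (fun s : Plane => H * η (R⁻¹ • s)) s
        (dir2 j)) ^ 2) ≤ (square R).indicator
          (fun _ => ENNReal.ofReal (2 * (H * (R⁻¹ * M)) ^ 2)) s := by
      by_cases hs : s ∈ square R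
      · rw [Set.indicator_of_mem hs]
        refine ENNReal.ofReal_le_ofReal ?_
        have hb (j : Fin 2) : (fderiv ℝ (fun s : Plane => H * η (R⁻¹ • s)) s (dir2 j)) ^ 2 ≤
            (H * (R⁻¹ * M)) ^ 2 := by
          rw [hd, sq_le_sq, abs_mul, abs_mul, abs_of_pos hH0, abs_of_pos (inv_pos.2 hR),
            abs_of_nonneg (a := H * (R⁻¹ * M)) (by positivity)]
          gcongr
          have hn : ‖dir2 j‖ ≤ 1 := by fin_cases j <;> simp [dir2, Prod.norm_def]
          calc |fderiv ℝ η (R⁻¹ • s) (dir2 j)| ≤ ‖fderiv ℝ η (R⁻¹ • s)‖ * ‖dir2 j‖ :=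
                (fderiv ℝ η (R⁻¹ • s)).le_opNorm _
            _ ≤ M * 1 := by gcongr; exact hM _
            _ = M := mul_one M
        rw [Fin.sum_univ_two]
        linarith [hb 0, hb 1]
      · rw [Set.indicator_of_notMem hs]
        have hz : fderiv ℝ η (R⁻¹ • s) = 0 := fderiv_of_notMem_tsupport ℝ (hout s hs)
        simp [hd, hz]
    refine (lintegral_mono hpt).trans ?_
    rw [lintegral_indicator_const (measurableSet_square R), volume_square hR,
      ← ENNReal.ofReal_mul (by positivity)]
    refine ENNReal.ofReal_le_ofReal ?_
    have : 2 * (H * (R⁻¹ * M)) ^ 2 * (16 * R ^ 2) = 32 * M ^ 2 / m ^ 2 * (V ^ 2 / R ^ 4) := by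
      rw [hH]; field_simp; ring
    rw [this]
    gcongr
    linarith

theorem exists_minEnergy_le_of_width : ∃ C : ℝ, 0 < C ∧ ∀ V R : ℝ, 0 < V → 0 < R →
    minEnergy V ≤ ENNReal.ofReal (C * (min V (R ^ 3) + V ^ 2 / R ^ 4)) := by
  obtain ⟨C₁, hC₁, hrel⟩ := exists_relaxation_bound
  obtain ⟨C₂, hC₂, hprof⟩ := exists_profile
  refine ⟨32 * C₁ + C₂, by positivity, fun V R hV hR => ?_⟩
  obtain ⟨h, hs, hc, hpos, hV', hsupp, hD⟩ := hprof V R hV hR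
  have hcont := hs.continuous
  have hint : Integrable h := hcont.integrable_of_hasCompactSupport hc
  have hfilm : MeasurableSet (film h) := measurableSet_film hcont
  have hmem (q : Space) (hq : q ∈ film h) : q.1 ∈ square R := by
    by_contra hn
    have h1 : q.2 < h q.1 := hq.2
    rw [hsupp _ hn] at h1
    exact lt_asymm hq.1 h1
  obtain ⟨B, hB⟩ := hcont.bounded_above_of_compact_support hc
  have hK : IsCompact (square R ×ˢ Set.Icc 0 B) :=
    (isCompact_Icc.prod isCompact_Icc).prod isCompact_Icc
  have hfK : film h ⊆ square R ×ˢ Set.Icc 0 B := fun q hq =>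
    ⟨hmem q hq, hq.1.le, hq.2.le.trans ((le_abs_self _).trans (hB _))⟩
  have cDh (j : Fin 2) : Continuous fun s => fderiv ℝ h s (dir2 j) :=
    (hs.continuous_fderiv (by simp)).clm_apply continuous_const
  have cDu (i : Fin 2) (j : Fin 3) : Continuous fun q => fderiv ℝ (relaxation R i) q (dir3 j) :=
    ((contDiff_relaxation R i).continuous_fderiv (by simp)).clm_apply continuous_const
  have hbot (i : Fin 2) (s : Plane) : relaxation R i (s, 0) = horizontal i (s, 0) := by
    simp [relaxation, Real.smoothTransition.one_of_one_le]
  have hadm : Admissible V h (fun s j => fderiv ℝ h s (dir2 j)) (relaxation R)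
      fun q i j => fderiv ℝ (relaxation R i) q (dir3 j) :=
    { continuous_profile := hcont
      profile_nonneg := hpos
      sobolev_profile := isSobolev_of_contDiff hs
        (by rw [Measure.restrict_univ]; exact hcont.memLp_of_hasCompactSupport hc)
        (fun j => by
          rw [Measure.restrict_univ]
          exact (cDh j).memLp_of_hasCompactSupport (hc.fderiv_apply ℝ (dir2 j)))
      integrable_profile := hint
      volume_eq := hV'
      sobolev_displacement := fun i => isSobolev_of_contDiff (contDiff_relaxation R i)
        (memLp_restrict_of_continuous hfilm hK hfK (contDiff_relaxation R i).continuous 2)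
        fun j => memLp_restrict_of_continuous hfilm hK hfK (cDu i j) 2
      trace_fst := by
        have := hasBottomTrace_of_contDiff (h := h) (contDiff_relaxation R 0)
        simp_rw [hbot] at this
        exact this
      trace_snd := by
        have := hasBottomTrace_of_contDiff (h := h) (contDiff_relaxation R 1)
        simp_rw [hbot] at this
        exact this }
  have hmin : minEnergy V ≤ energy h (fun s j => fderiv ℝ h s (dir2 j))
      fun q i j => fderiv ℝ (relaxation R i) q (dir3 j) := sInf_le ⟨_, _, _, _, hadm, rfl⟩
  refine hmin.trans ?_
  have hpt (q : Space) (hq : q ∈ film h) : ENNReal.ofReal (∑ i, ∑ j,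
      (fderiv ℝ (relaxation R i) q (dir3 j)) ^ 2) ≤
        (square R ×ˢ Set.Icc 0 (2 * R)).indicator (fun _ => ENNReal.ofReal C₁) q := by
    have hsq := hmem q hq
    refine (ENNReal.ofReal_le_ofReal
      (hrel R hR q (abs_le.2 hsq.1) (abs_le.2 hsq.2))).trans ?_
    by_cases h2 : q.2 ≤ 2 * R
    · rw [Set.indicator_of_mem (show q.2 ∈ Set.Iic (2 * R) from h2),
        Set.indicator_of_mem (show q ∈ square R ×ˢ Set.Icc 0 (2 * R) from ⟨hsq, hq.1.le, h2⟩)]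
    · rw [Set.indicator_of_notMem (show q.2 ∉ Set.Iic (2 * R) from h2)]
      simp
  have hel : ∫⁻ q in film h, ENNReal.ofReal (∑ i, ∑ j,
      (fderiv ℝ (relaxation R i) q (dir3 j)) ^ 2) ≤
        ENNReal.ofReal (32 * C₁ * min V (R ^ 3)) := by
    refine (setLIntegral_mono' hfilm hpt).trans ?_
    -- The bounded elastic density is integrated either over the film, of volume `V`, or over the
    -- box of height `2R` on the square, of volume `32 R³`.
    rw [mul_min_of_nonneg _ _ (by positivity), ENNReal.ofReal_min, le_min_iff]
    constructor
    · calc _ ≤ ∫⁻ q in film h, ENNReal.ofReal C₁ :=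
            lintegral_mono fun q => Set.indicator_le_self _ (fun _ => ENNReal.ofReal C₁) q
        _ = ENNReal.ofReal C₁ * ENNReal.ofReal V := by
            rw [setLIntegral_const, volume_film hcont, ← hV',
              ofReal_integral_eq_lintegral_ofReal hint (Eventually.of_forall hpos)]
        _ ≤ ENNReal.ofReal (32 * C₁ * V) := by
            rw [← ENNReal.ofReal_mul hC₁.le]
            refine ENNReal.ofReal_le_ofReal ?_
            nlinarith [mul_pos hC₁ hV]
    · calc _ ≤ ∫⁻ q, (square R ×ˢ Set.Icc 0 (2 * R)).indicator
              (fun _ => ENNReal.ofReal C₁) q := setLIntegral_le_lintegral _ _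
        _ = ENNReal.ofReal C₁ * (ENNReal.ofReal (16 * R ^ 2) * ENNReal.ofReal (2 * R)) := by
            rw [lintegral_indicator_const ((measurableSet_square R).prod measurableSet_Icc),
              Measure.volume_eq_prod, Measure.prod_prod, volume_square hR, Real.volume_Icc,
              sub_zero]
        _ = _ := by
            rw [← ENNReal.ofReal_mul (by positivity), ← ENNReal.ofReal_mul (by positivity)]
            congr 1; ring
  calc _ ≤ ENNReal.ofReal (32 * C₁ * min V (R ^ 3)) + ENNReal.ofReal (C₂ * (V ^ 2 / R ^ 4)) :=
        add_le_add hel hD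
    _ = ENNReal.ofReal (32 * C₁ * min V (R ^ 3) + C₂ * (V ^ 2 / R ^ 4)) :=
        (ENNReal.ofReal_add (by positivity) (by positivity)).symm
    _ ≤ _ := by
        refine ENNReal.ofReal_le_ofReal ?_
        have h1 : 0 ≤ C₂ * min V (R ^ 3) := by positivity
        have h2 : 0 ≤ 32 * C₁ * (V ^ 2 / R ^ 4) := by positivity
        nlinarith

theorem exists_minEnergy_le : ∃ C : ℝ, 0 < C ∧ ∀ V : ℝ, 0 < V →
    minEnergy V ≤ ENNReal.ofReal (C * min V (V ^ (6 / 7 : ℝ))) := by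
  obtain ⟨C, hC, hle⟩ := exists_minEnergy_le_of_width
  refine ⟨2 * C, by positivity, fun V hV => ?_⟩
  rcases le_total V 1 with h1 | h1
  -- At unit width the Dirichlet term is of order `V² ≤ V`.
  · refine (hle V 1 hV one_pos).trans (ENNReal.ofReal_le_ofReal ?_)
    have hmin : min V (V ^ (6 / 7 : ℝ)) = V := by
      refine min_eq_left ?_
      calc V = V ^ (1 : ℝ) := (Real.rpow_one V).symm
        _ ≤ V ^ (6 / 7 : ℝ) := Real.rpow_le_rpow_of_exponent_ge hV h1 (by norm_num)
    have h2 : min V (1 ^ 3) ≤ V := min_le_left _ _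
    have h3 : V ^ 2 / 1 ^ 4 ≤ V := by rw [one_pow, div_one]; nlinarith
    rw [hmin]
    calc _ ≤ C * (V + V) := by gcongr
      _ = _ := by ring
  -- This width balances `R³` with `V²/R⁴`; both equal `V^(6/7)`.
  · refine (hle V (V ^ (2 / 7 : ℝ)) hV (by positivity)).trans (ENNReal.ofReal_le_ofReal ?_)
    have hmin : min V (V ^ (6 / 7 : ℝ)) = V ^ (6 / 7 : ℝ) := by
      refine min_eq_right ?_
      calc V ^ (6 / 7 : ℝ) ≤ V ^ (1 : ℝ) :=
            Real.rpow_le_rpow_of_exponent_le h1 (by norm_num)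
        _ = V := Real.rpow_one V
    have h2 : min V ((V ^ (2 / 7 : ℝ)) ^ 3) ≤ V ^ (6 / 7 : ℝ) := by
      refine (min_le_right _ _).trans_eq ?_
      rw [← Real.rpow_natCast, ← Real.rpow_mul hV.le]; norm_num
    have h3 : V ^ 2 / (V ^ (2 / 7 : ℝ)) ^ 4 = V ^ (6 / 7 : ℝ) := by
      rw [← Real.rpow_natCast (V ^ (2 / 7 : ℝ)), ← Real.rpow_mul hV.le, ← Real.rpow_natCast V,
        ← Real.rpow_sub hV]
      norm_num
    rw [hmin, h3]
    calc _ ≤ C * (V ^ (6 / 7 : ℝ) + V ^ (6 / 7 : ℝ)) := by gcongr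
      _ = _ := by ring

end ThinFilm

theorem mainTheorem12 :
    ∃ c : ℝ, 0 < c ∧ ∀ V : ℝ, 0 < V →
      ENNReal.ofReal (c * min V (V ^ (6 / 7 : ℝ))) ≤ ThinFilm.minEnergy V ∧
      ThinFilm.minEnergy V ≤ ENNReal.ofReal (c⁻¹ * min V (V ^ (6 / 7 : ℝ))) := by
  obtain ⟨c, hc, hlow⟩ := ThinFilm.exists_le_minEnergy
  obtain ⟨C, hC, hup⟩ := ThinFilm.exists_minEnergy_le
  refine ⟨min c C⁻¹, by positivity, fun V hV => ⟨?_, ?_⟩⟩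
  · refine (ENNReal.ofReal_le_ofReal ?_).trans (hlow V hV)
    gcongr
    exact min_le_left _ _
  · refine (hup V hV).trans (ENNReal.ofReal_le_ofReal ?_)
    gcongr
    rw [le_inv_comm₀ hC (by positivity)]
    exact min_le_right _ _
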